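/- Let $K$ be a field of characteristic zero, let $n \ge 1$, let $R = K[X_1,\ldots,X_n]$, and let $P = (X_1,\ldots,X_{n-1}) \subset R$ (so $P = 0$ if $n = 1$). Let $H^{n-1}_P(R)$ be the $(n-1)$-st local cohomology module of $R$ with support in $P$, that is, the $(n-1)$-st cohomology of the Čech complex $$0 \to R \to \bigoplus_{j} R_{a_j} \to \bigoplus_{j<k} R_{a_j a_k} \to \cdots \to R_{a_1 \cdots a_s} \to 0$$ of any finite sequence $a_1,\ldots,a_s$ generating $P$, on which the partial derivatives $\partial_1,\ldots,\partial_n$ act through their unique extensions (the quotient rule) to the localizations of $R$. Let $\partial = \partial_1,\ldots,\partial_n$, and for $i \ge 0$ let $H_i(\partial; H^{n-1}_P(R))$ be the $i$-th Koszul (de Rham) homology of the $K$-vector space $H^{n-1}_P(R)$ with respect to the pairwise commuting $K$-linear operators $\partial_1,\ldots,\partial_n$. Then $$H_i(\partial; H^{n-1}_P(R)) \cong \begin{cases} 0 & \text{for } i \neq 1, \\ K & \text{for } i = 1, \end{cases}$$ as $K$-vector spaces. -/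

import Mathlib

noncomputable section

namespace DeRhamLC

/-! ### Derivations on localizations -/

section LocDerivation

variable {K R : Type*} [CommRing K] [CommRing R] [Algebra K R]

/-- For a `K`-derivation `D` of `R`, the ring homomorphism `r ↦ (r, D r)` from `R` to the
square-zero extension `M⁻¹R ⊕ M⁻¹R ε` of a localization of `R`. -/
def dualHom (D : Derivation K R R) (M : Submonoid R) :
    R →ₐ[K] TrivSqZeroExt (Localization M) (Localization M) :=
  AlgHom.ofLinearMap
    { toFun := fun r => (algebraMap R (Localization M) r, algebraMap R (Localization M) (D r))
      map_add' := fun x y => Prod.ext (map_add _ x y) (by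
        change algebraMap R (Localization M) (D (x + y)) = _ + _
        rw [map_add, map_add])
      map_smul' := fun k x => Prod.ext ((IsScalarTower.toAlgHom K R (Localization M)).toLinearMap.map_smul k x) (by
        change algebraMap R (Localization M) (D (k • x)) = k • _
        rw [D.map_smul]
        exact (IsScalarTower.toAlgHom K R (Localization M)).toLinearMap.map_smul k (D x)) }
    (Prod.ext (map_one _) (by
        change algebraMap R (Localization M) (D 1) = 0
        rw [D.map_one_eq_zero, map_zero]))
    (fun x y => Prod.ext (map_mul _ x y) (by
        change algebraMap R (Localization M) (D (x * y)) =
          algebraMap R (Localization M) x * algebraMap R (Localization M) (D y) +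
          algebraMap R (Localization M) (D x) * algebraMap R (Localization M) y
        rw [D.leibniz, map_add, smul_eq_mul, smul_eq_mul, map_mul, map_mul, mul_comm
          (algebraMap R (Localization M) y)]))

theorem isUnit_dualHom (D : Derivation K R R) (M : Submonoid R) (y : M) :
    IsUnit (dualHom D M (y : R)) := by
  rw [TrivSqZeroExt.isUnit_iff_isUnit_fst]
  exact IsLocalization.map_units (Localization M) y

/-- The extension of `dualHom` to the localization. -/
def dualLift (D : Derivation K R R) (M : Submonoid R) :
    Localization M →ₐ[K] TrivSqZeroExt (Localization M) (Localization M) :=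
  IsLocalization.liftAlgHom (M := M) (f := dualHom D M) (isUnit_dualHom D M)

theorem dualLift_algebraMap (D : Derivation K R R) (M : Submonoid R) (r : R) :
    dualLift D M (algebraMap R (Localization M) r) = dualHom D M r := by
  simp [dualLift]

theorem fst_dualLift (D : Derivation K R R) (M : Submonoid R) (x : Localization M) :
    (dualLift D M x).fst = x := by
  have h : ((TrivSqZeroExt.fstHom K (Localization M) (Localization M)).comp
      (dualLift D M)).toRingHom = RingHom.id _ := by
    apply IsLocalization.ringHom_ext M
    ext r
    change (dualLift D M (algebraMap R (Localization M) r)).fst = _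
    rw [dualLift_algebraMap]
    rfl
  exact congrArg (fun f : Localization M →+* Localization M => f x) h

/-- The unique extension of a `K`-derivation `D` of `R` to a `K`-derivation of the localization
`M⁻¹R` (given by the quotient rule). -/
def locDerivation (D : Derivation K R R) (M : Submonoid R) :
    Derivation K (Localization M) (Localization M) :=
  Derivation.mk'
    ((TrivSqZeroExt.sndHom (Localization M) (Localization M)).restrictScalars K ∘ₗ
      (dualLift D M).toLinearMap)
    (fun x y => by
      change (dualLift D M (x * y)).snd = x * (dualLift D M y).snd + y * (dualLift D M x).snd
      rw [map_mul, TrivSqZeroExt.snd_mul, fst_dualLift, fst_dualLift]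
      simp [mul_comm])

theorem locDerivation_algebraMap (D : Derivation K R R) (M : Submonoid R) (r : R) :
    locDerivation D M (algebraMap R (Localization M) r) = algebraMap R (Localization M) (D r) := by
  change (dualLift D M (algebraMap R (Localization M) r)).snd = _
  rw [dualLift_algebraMap]
  rfl

/-- The extensions of a derivation are compatible with homomorphisms of localizations. -/
theorem locDerivation_map (D : Derivation K R R) {M N : Submonoid R}
    (f : Localization M →ₐ[R] Localization N) (x : Localization M) :
    f (locDerivation D M x) = locDerivation D N (f x) := by
  obtain ⟨r, s, rfl⟩ := IsLocalization.exists_mk'_eq M x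
  set y := IsLocalization.mk' (Localization M) r s with hy
  have hm : algebraMap R (Localization M) s * y = algebraMap R (Localization M) r := by
    rw [hy, mul_comm, IsLocalization.mk'_spec]
  have hu : IsUnit (algebraMap R (Localization N) (s : R)) := by
    have := (IsLocalization.map_units (Localization M) s).map f
    rwa [f.commutes] at this
  have h1 := congrArg (fun z => f (locDerivation D M z)) hm
  have h2 := congrArg (fun z => locDerivation D N (f z)) hm
  simp only [map_mul, AlgHom.commutes, Derivation.leibniz, smul_eq_mul,
    locDerivation_algebraMap, map_add] at h1 h2
  exact hu.mul_left_cancel (add_right_cancel (h1.trans h2.symm))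

theorem locDerivation_comm {D E : Derivation K R R} (h : ∀ r, D (E r) = E (D r))
    (M : Submonoid R) (x : Localization M) :
    locDerivation D M (locDerivation E M x) = locDerivation E M (locDerivation D M x) := by
  obtain ⟨r, s, rfl⟩ := IsLocalization.exists_mk'_eq M x
  set y := IsLocalization.mk' (Localization M) r s with hy
  have hm : algebraMap R (Localization M) s * y = algebraMap R (Localization M) r := by
    rw [hy, mul_comm, IsLocalization.mk'_spec]
  have hu : IsUnit (algebraMap R (Localization M) (s : R)) := IsLocalization.map_units _ s
  have h1 := congrArg (fun z => locDerivation D M (locDerivation E M z)) hm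
  have h2 := congrArg (fun z => locDerivation E M (locDerivation D M z)) hm
  simp only [Derivation.leibniz, smul_eq_mul, locDerivation_algebraMap, map_add, h] at h1 h2
  refine hu.mul_left_cancel ?_
  linear_combination h1 - h2

end LocDerivation

/-! ### Graded pieces and signs -/

/-- The sign `(-1)^k`, where `k` is the number of elements of `T` that are smaller than `j`. -/
def alternatingSign {ι : Type*} [LinearOrder ι] (j : ι) (T : Finset ι) : ℤ :=
  (-1) ^ (T.filter (· < j)).card

/-- For a family `V` of modules indexed by finite sets, the families in `∏ S, V S` that are
concentrated on the sets with `p` elements, i.e. the submodule `∏_{|S| = p} V S`. -/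
def gradedPiece (A : Type*) [Ring A] {ι : Type*} (V : Finset ι → Type*)
    [∀ S, AddCommGroup (V S)] [∀ S, Module A (V S)] (p : ℕ) : Submodule A (∀ S, V S) where
  carrier := {c | ∀ S, S.card ≠ p → c S = 0}
  add_mem' := fun ha hb S hS => by simp [ha S hS, hb S hS]
  zero_mem' := fun _ _ => rfl
  smul_mem' := fun r c hc S hS => by simp [hc S hS]

theorem alternatingSign_swap {ι : Type*} [LinearOrder ι] {j k : ι} {T : Finset ι} (hjk : j ≠ k)
    (hj : j ∉ T) (hk : k ∉ T) :
    alternatingSign j T * alternatingSign k (insert j T) =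
      -(alternatingSign k T * alternatingSign j (insert k T)) := by
  have key : ∀ a b : ι, a ∉ T → alternatingSign b (insert a T) =
      if a < b then -alternatingSign b T else alternatingSign b T := by
    intro a b ha
    unfold alternatingSign
    rw [Finset.filter_insert]
    split_ifs with h
    · rw [Finset.card_insert_of_notMem (by simp [ha]), pow_succ]; ring
    · rfl
  rw [key j k hj, key k j hk]
  rcases lt_or_gt_of_ne hjk with h | h
  · rw [if_pos h, if_neg h.le.not_gt]; ring
  · rw [if_neg h.le.not_gt, if_pos h]; ring

/-! ### The Čech complex and local cohomology -/

section Cech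

variable {R : Type*} [CommRing R] {s : ℕ} (a : Fin s → R)

/-- The localization `R_{a_S}` of `R` at the product `a_S = ∏_{j ∈ S} a_j`. -/
abbrev CechLoc (S : Finset (Fin s)) : Type _ := Localization.Away (∏ j ∈ S, a j)

/-- The localization map `R_{a_S} → R_{a_T}` for `S ⊆ T`. -/
def cechRestrict {S T : Finset (Fin s)} (h : S ⊆ T) : CechLoc a S →ₐ[R] CechLoc a T :=
  IsLocalization.Away.liftAlgHom (∏ j ∈ S, a j) (f := Algebra.ofId R (CechLoc a T))
    (IsLocalization.Away.isUnit_of_dvd (S := CechLoc a T) (∏ j ∈ T, a j)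
      (Finset.prod_dvd_prod_of_subset S T a h))

/-- The total Čech module `∏_S R_{a_S}`; its degree `p` part is `∏_{|S| = p} R_{a_S}`. -/
abbrev CechCochain : Type _ := ∀ S : Finset (Fin s), CechLoc a S

/-- The Čech differential
`(d c)_T = ∑_{j ∈ T} (-1)^{#{i ∈ T : i < j}} c_{T \ {j}} |_{R_{a_T}}`, which raises the degree
by one. -/
def cechD : CechCochain a →ₗ[R] CechCochain a :=
  LinearMap.pi fun T => ∑ j ∈ T, alternatingSign j T •
    ((cechRestrict a (Finset.erase_subset j T)).toLinearMap ∘ₗ LinearMap.proj (T.erase j))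

theorem cechD_apply (c : CechCochain a) (T : Finset (Fin s)) :
    cechD a c T = ∑ j ∈ T, alternatingSign j T •
      cechRestrict a (Finset.erase_subset j T) (c (T.erase j)) := by
  simp [cechD, LinearMap.sum_apply]

theorem cechRestrict_comp {S T U : Finset (Fin s)} (h : S ⊆ T) (h' : T ⊆ U) (x : CechLoc a S) :
    cechRestrict a h' (cechRestrict a h x) = cechRestrict a (h.trans h') x := by
  have e : ((cechRestrict a h').comp (cechRestrict a h)).toRingHom =
      (cechRestrict a (h.trans h')).toRingHom := by
    apply IsLocalization.ringHom_ext (Submonoid.powers (∏ j ∈ S, a j))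
    ext r
    simp
  exact congrArg (fun f : CechLoc a S →+* CechLoc a U => f x) e

theorem cechD_comp_cechD (c : CechCochain a) : cechD a (cechD a c) = 0 := by
  ext T
  simp only [cechD_apply, map_sum, Finset.smul_sum, Pi.zero_apply, map_zsmul, cechRestrict_comp,
    smul_smul]
  rw [Finset.sum_sigma']
  refine Finset.sum_involution (fun x _ => ⟨x.2, x.1⟩) ?_ ?_ ?_ ?_
  · rintro ⟨j, k⟩ hx
    simp only [Finset.mem_sigma, Finset.mem_erase] at hx
    obtain ⟨hj, hkj, hk⟩ := hx
    have aux : ∀ (U V : Finset (Fin s)) (hU : U ⊆ T) (hV : V ⊆ T), U = V →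
        cechRestrict a hU (c U) = cechRestrict a hV (c V) := by
      rintro U _ hU hV rfl; rfl
    have hs := alternatingSign_swap (T := (T.erase j).erase k) (Ne.symm hkj)
      (by simp) (by simp)
    rw [Finset.insert_erase (by simp [hkj, hk] : k ∈ T.erase j), Finset.erase_right_comm,
      Finset.insert_erase (by simp [hkj.symm, hj] : j ∈ T.erase k)] at hs
    have key : ∀ a b : Fin s, a ∈ T → a ≠ b → alternatingSign b T =
        (if a < b then -1 else 1) * alternatingSign b (T.erase a) := by
      intro a b ha hab
      conv_lhs => rw [← Finset.insert_erase ha]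
      unfold alternatingSign
      rw [Finset.filter_insert]
      split_ifs with h
      · rw [Finset.card_insert_of_notMem (by simp), pow_succ]; ring
      · ring
    rw [aux _ _ _ ((Finset.erase_subset _ _).trans (Finset.erase_subset _ _))
      (Finset.erase_right_comm (s := T) (a := j) (b := k)), ← add_smul]
    rw [key k j hk hkj, key j k hj hkj.symm]
    rcases lt_or_gt_of_ne hkj with h | h
    · rw [if_pos h, if_neg h.le.not_gt]
      convert zero_smul ℤ _ using 2; ring
    · rw [if_neg h.le.not_gt, if_pos h]
      convert zero_smul ℤ _ using 2; ring
  · rintro ⟨j, k⟩ hx _ h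
    simp only [Finset.mem_sigma, Finset.mem_erase] at hx
    simp only [Sigma.mk.injEq, heq_eq_eq] at h
    exact hx.2.1 h.1
  · rintro ⟨j, k⟩ hx
    simp only [Finset.mem_sigma, Finset.mem_erase] at hx ⊢
    exact ⟨hx.2.2, hx.2.1.symm, hx.1⟩
  · rintro ⟨j, k⟩ _; rfl

/-- Čech cocycles of degree `p`. -/
def cechCocycles (p : ℕ) : Submodule R (CechCochain a) :=
  gradedPiece R (CechLoc a) p ⊓ LinearMap.ker (cechD a)

/-- Čech coboundaries of degree `p`: since `d` is homogeneous of degree one, these are the elements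
of the image of `d` that lie in degree `p`. -/
def cechCoboundaries (p : ℕ) : Submodule R (cechCocycles a p) :=
  (LinearMap.range (cechD a)).comap (cechCocycles a p).subtype

/-- The `p`-th Čech cohomology module of `R` with respect to the finite sequence `a`. If `R` is
Noetherian and `I` is the ideal generated by `a`, this is the local cohomology module
`H^p_I(R)`. -/
abbrev CechCohomology (p : ℕ) : Type _ := cechCocycles a p ⧸ cechCoboundaries a p

variable {K : Type*} [CommRing K] [Algebra K R]

/-- A derivation of `R` acts on the Čech module through its extensions to all `R_{a_S}`. -/
def cechAction (D : Derivation K R R) : Module.End K (CechCochain a) :=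
  LinearMap.pi fun S =>
    (locDerivation D (Submonoid.powers (∏ j ∈ S, a j)) : CechLoc a S →ₗ[K] CechLoc a S) ∘ₗ
      LinearMap.proj S

theorem cechAction_apply (D : Derivation K R R) (c : CechCochain a) (S : Finset (Fin s)) :
    cechAction a D c S = locDerivation D (Submonoid.powers (∏ j ∈ S, a j)) (c S) := rfl

theorem cechD_cechAction (D : Derivation K R R) (c : CechCochain a) :
    cechD a (cechAction a D c) = cechAction a D (cechD a c) := by
  ext T
  simp only [cechD_apply, cechAction_apply, map_sum, map_zsmul]
  refine Finset.sum_congr rfl fun j _ => ?_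
  rw [locDerivation_map]

theorem cechAction_mem (D : Derivation K R R) (p : ℕ) {c : CechCochain a}
    (hc : c ∈ cechCocycles a p) : cechAction a D c ∈ cechCocycles a p := by
  refine ⟨fun S hS => ?_, ?_⟩
  · rw [cechAction_apply, hc.1 S hS, map_zero]
  · change cechD a (cechAction a D c) = 0
    rw [cechD_cechAction, LinearMap.mem_ker.1 hc.2, map_zero]

/-- The action of a derivation of `R` on the Čech cocycles of degree `p`. -/
def cocycleAction (D : Derivation K R R) (p : ℕ) : Module.End K (cechCocycles a p) where
  toFun c := ⟨cechAction a D c.1, cechAction_mem a D p c.2⟩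
  map_add' x y := Subtype.ext (map_add (cechAction a D) x.1 y.1)
  map_smul' k x := Subtype.ext (map_smul (cechAction a D) k x.1)

/-- The induced action of a derivation of `R` on the local cohomology module. -/
def cohomologyAction (D : Derivation K R R) (p : ℕ) : Module.End K (CechCohomology a p) :=
  ((cechCoboundaries a p).restrictScalars K).mapQ ((cechCoboundaries a p).restrictScalars K)
    (cocycleAction a D p) (by
      rintro x ⟨y, hy⟩
      exact ⟨cechAction a D y, by rw [cechD_cechAction, hy]; rfl⟩)

theorem cohomologyAction_mk (D : Derivation K R R) (p : ℕ) (c : cechCocycles a p) :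
    cohomologyAction a D p (Submodule.Quotient.mk c) =
      Submodule.Quotient.mk (cocycleAction a D p c) := rfl

end Cech

/-! ### Koszul (de Rham) homology -/

section Koszul

variable {K M ι : Type*} [CommRing K] [AddCommGroup M] [Module K M] [Fintype ι] [LinearOrder ι]

/-- The Koszul differential of a family `φ` of endomorphisms of `M` on `⨁_S M e_S`:
`(d m)_T = ∑_{j ∉ T} (-1)^{#{i ∈ T : i < j}} φ_j (m_{T ∪ {j}})`, i.e.
`d (m e_{j_0 < ⋯ < j_p}) = ∑_k (-1)^k φ_{j_k} m e_{j_0 ⋯ ĵ_k ⋯ j_p}`. It lowers the degree by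
one. -/
def koszulD (φ : ι → Module.End K M) : Module.End K (Finset ι → M) :=
  LinearMap.pi fun T => ∑ j ∈ Tᶜ, alternatingSign j T • (φ j ∘ₗ LinearMap.proj (insert j T))

theorem koszulD_apply (φ : ι → Module.End K M) (m : Finset ι → M) (T : Finset ι) :
    koszulD φ m T = ∑ j ∈ Tᶜ, alternatingSign j T • φ j (m (insert j T)) := by
  simp [koszulD, LinearMap.sum_apply]

theorem koszulD_comp_koszulD {φ : ι → Module.End K M} (hφ : ∀ i j, Commute (φ i) (φ j))
    (m : Finset ι → M) : koszulD φ (koszulD φ m) = 0 := by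
  ext T
  simp only [koszulD_apply, map_sum, Finset.smul_sum, Pi.zero_apply, map_zsmul, smul_smul]
  rw [Finset.sum_sigma']
  refine Finset.sum_involution (fun x _ => ⟨x.2, x.1⟩) ?_ ?_ ?_ ?_
  · rintro ⟨j, k⟩ hx
    simp only [Finset.mem_sigma, Finset.mem_compl, Finset.mem_insert, not_or] at hx
    obtain ⟨hj, hkj, hk⟩ := hx
    have hc : φ k (φ j (m (insert j (insert k T)))) = φ j (φ k (m (insert j (insert k T)))) :=
      congrArg (fun f : Module.End K M => f (m (insert j (insert k T)))) (hφ k j)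
    simp only [Finset.insert_comm k j, hc]
    rw [alternatingSign_swap (Ne.symm hkj) hj hk, neg_smul, neg_add_cancel]
  · rintro ⟨j, k⟩ hx _ h
    simp only [Finset.mem_sigma, Finset.mem_compl, Finset.mem_insert, not_or] at hx
    simp only [Sigma.mk.injEq, heq_eq_eq] at h
    exact hx.2.1 h.1
  · rintro ⟨j, k⟩ hx
    simp only [Finset.mem_sigma, Finset.mem_compl, Finset.mem_insert, not_or] at hx ⊢
    exact ⟨hx.2.2, Ne.symm hx.2.1, hx.1⟩
  · rintro ⟨j, k⟩ _; rfl

/-- Koszul cycles of degree `i`. -/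
def koszulCycles (φ : ι → Module.End K M) (i : ℕ) : Submodule K (Finset ι → M) :=
  gradedPiece K (fun _ => M) i ⊓ LinearMap.ker (koszulD φ)

/-- Koszul boundaries of degree `i`: since `d` is homogeneous of degree `-1`, these are the elements
of the image of `d` that lie in degree `i`. -/
def koszulBoundaries (φ : ι → Module.End K M) (i : ℕ) : Submodule K (koszulCycles φ i) :=
  (LinearMap.range (koszulD φ)).comap (koszulCycles φ i).subtype

/-- The `i`-th Koszul homology `H_i(φ; M)` of a finite family of pairwise commuting `K`-linear
endomorphisms of `M`. -/
abbrev KoszulHomology (φ : ι → Module.End K M) (i : ℕ) : Type _ :=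
  koszulCycles φ i ⧸ koszulBoundaries φ i

end Koszul

/-! ### The partial derivatives on local cohomology of a polynomial ring -/

/-- The operators `∂_1, …, ∂_n` on the local cohomology module `H^p_I(K[X_1, …, X_n])`, where `I` is
generated by the finite sequence `a`. -/
def partialOp {K : Type*} [Field K] {n s : ℕ} (a : Fin s → MvPolynomial (Fin n) K) (p : ℕ) :
    Fin n → Module.End K (CechCohomology a p) :=
  fun i => cohomologyAction a (MvPolynomial.pderiv i) p

theorem partialOp_commute {K : Type*} [Field K] {n s : ℕ} (a : Fin s → MvPolynomial (Fin n) K)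
    (p : ℕ) (i j : Fin n) : Commute (partialOp a p i) (partialOp a p j) := by
  have h : ∀ r : MvPolynomial (Fin n) K, MvPolynomial.pderiv i (MvPolynomial.pderiv j r) =
      MvPolynomial.pderiv j (MvPolynomial.pderiv i r) := by
    let D (l : Fin n) : Derivation K (MvPolynomial (Fin n) K) (MvPolynomial (Fin n) K) :=
      MvPolynomial.pderiv l
    have h0 : ⁅D i, D j⁆ = 0 := by
      refine MvPolynomial.derivation_ext fun k => ?_
      simp [D, Derivation.commutator_apply, MvPolynomial.pderiv_X, Pi.single_apply, apply_ite]
    intro r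
    have h1 := congrArg (fun D : Derivation K (MvPolynomial (Fin n) K) (MvPolynomial (Fin n) K) => D r) h0
    simpa [D, Derivation.commutator_apply, sub_eq_zero] using h1
  refine LinearMap.ext fun x => ?_
  obtain ⟨c, rfl⟩ := Submodule.Quotient.mk_surjective _ x
  refine congrArg Submodule.Quotient.mk (Subtype.ext (funext fun S => ?_))
  exact locDerivation_comm (D := MvPolynomial.pderiv i) (E := MvPolynomial.pderiv j) h _ _

end DeRhamLC

end

/-! Write n = m + 1 and let x = (X_1, …, X_m). The proof replaces `a` by x, makes the cohomology
explicit in a basis of Laurent monomials, and contracts the Koszul complex one variable at a time.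

Independence of the generators: both `a` and x are subsequences of their concatenation b.
Restricting Čech cochains from b to a subsequence indexed by U is surjective, with kernel the
cochains vanishing on all subsets of U. This kernel is acyclic when every entry of b lies in the
ideal generated by the entries in U (`exists_cechD_eq_of_vanishing`), so restriction is an
isomorphism on cohomology. It commutes with derivations because their extensions to localizations
are compatible with all R-algebra maps (`exists_cechCohomology_equiv_comp`).

Monomial basis: the top Čech cohomology of x has as K-basis the classes δ_α of X_{m+1}^{α_{m+1}} ∏
X_i^{-1-α_i} (`modelMap_surjective`, `modelMap_injective`). For i ≤ m, ∂_i sends δ_α to -(α_i + 1)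
δ_{α+e_i}; the last derivative sends δ_α to α_{m+1} δ_{α-e_{m+1}} (`modelMap_modelOp`).

Koszul homology: in characteristic zero, the first m operators are injective with cokernel spanned
by the δ_α with α_i = 0, and the last is surjective with kernel spanned by the δ_α with α_{m+1} = 0.
Explicit one-sided inverses give a homotopy for each variable (`koszulD_koszulHomotopy_add`,
`survivor_eq`). After all of them only the multiples of δ_0 e_{m+1} remain, a single copy of K in
degree one. -/

noncomputable section

namespace DeRhamLC

/-! ### Sign identities. -/

section Signs

variable {ι : Type*} [LinearOrder ι]

theorem alternatingSign_mul_self (j : ι) (T : Finset ι) :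
    alternatingSign j T * alternatingSign j T = 1 := by
  unfold alternatingSign
  rw [← mul_pow]; simp

theorem alternatingSign_insert_self (j : ι) (T : Finset ι) :
    alternatingSign j (insert j T) = alternatingSign j T := by
  simp [alternatingSign, Finset.filter_insert]

theorem alternatingSign_erase_self (j : ι) (T : Finset ι) :
    alternatingSign j (T.erase j) = alternatingSign j T := by
  by_cases h : j ∈ T
  · conv_rhs => rw [← Finset.insert_erase h, alternatingSign_insert_self]
  · rw [Finset.erase_eq_of_notMem h]

/-- The sign rule behind the contraction of Koszul and Čech complexes. -/
theorem alternatingSign_erase {i j : ι} {T : Finset ι} (hi : i ∈ T) (hj : j ∉ T) :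
    alternatingSign i T * alternatingSign j (T.erase i) =
      -(alternatingSign j T * alternatingSign i (insert j T)) := by
  have hij : i ≠ j := fun h => hj (h ▸ hi)
  have h := alternatingSign_swap (T := T.erase i) hij (by simp) (by simp [hj])
  have e : insert j T = insert i (insert j (T.erase i)) := by
    rw [Finset.insert_comm, Finset.insert_erase hi]
  rw [Finset.insert_erase hi, alternatingSign_erase_self] at h
  rw [e, alternatingSign_insert_self]
  have h1 := alternatingSign_mul_self j T
  have h2 := alternatingSign_mul_self j (T.erase i)
  have h3 := alternatingSign_mul_self i (insert j (T.erase i))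
  linear_combination (alternatingSign j (T.erase i) * alternatingSign j T) * h -
    alternatingSign i T * alternatingSign j (T.erase i) * h1 -
    (alternatingSign i (insert j (T.erase i)) * alternatingSign j T) * h2

end Signs

/-! ### Acyclicity of the relative Čech complex. -/

section CechAcyclic

variable {R : Type*} [CommRing R] {t : ℕ} (b : Fin t → R)

theorem isUnit_algebraMap_cechLoc {S : Finset (Fin t)} {j : Fin t} (hj : j ∈ S) :
    IsUnit (algebraMap R (CechLoc b S) (b j)) :=
  IsLocalization.Away.isUnit_of_dvd (S := CechLoc b S) (∏ j ∈ S, b j)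
    (Finset.dvd_prod_of_mem b hj)

theorem cechRestrict_self {S : Finset (Fin t)} (h : S ⊆ S) (x : CechLoc b S) :
    cechRestrict b h x = x := by
  have := IsLocalization.algHom_subsingleton (R := R) (S := CechLoc b S) (P := CechLoc b S)
    (Submonoid.powers (∏ j ∈ S, b j))
  exact congrArg (fun f : CechLoc b S →ₐ[R] CechLoc b S => f x)
    (Subsingleton.elim (cechRestrict b h) (AlgHom.id R _))

/-- Adjoining j to T inverts `b j` in R_{b_T}, so large powers of `b j` clear the new denominators.
Allowing every n ≥ N lets finitely many T share one exponent; the same holds for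
`exists_pow_smul_eq_zero`, which treats the kernel. -/
theorem exists_cechRestrict_eq_pow_smul {T : Finset (Fin t)} {j : Fin t} (hj : j ∉ T)
    (x : CechLoc b (insert j T)) :
    ∃ N, ∀ n ≥ N, ∃ l : CechLoc b T,
      cechRestrict b (Finset.subset_insert j T) l = b j ^ n • x := by
  obtain ⟨N, r, h⟩ := IsLocalization.Away.surj (∏ i ∈ insert j T, b i) x
  refine ⟨N, fun n hn => ?_⟩
  have hu : IsUnit (algebraMap R (CechLoc b T) (∏ i ∈ T, b i)) :=
    IsLocalization.Away.algebraMap_isUnit _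
  obtain ⟨v, hv⟩ := (hu.pow N).exists_left_inv
  -- Since (b_j b_T)^N x = r, the element b_j^n x is b_j^(n-N) r / b_T^N, and `v` is the inverse of
  -- b_T^N.
  refine ⟨b j ^ (n - N) • (v * algebraMap R _ r), ?_⟩
  have hu' := (hu.pow N).map (cechRestrict b (Finset.subset_insert j T))
  apply hu'.mul_left_cancel
  rw [map_smul, mul_smul_comm, ← map_mul, ← mul_assoc, mul_comm _ v, hv, one_mul,
    AlgHom.commutes, ← h, map_pow, AlgHom.commutes]
  have hp : algebraMap R (CechLoc b (insert j T)) (∏ i ∈ insert j T, b i) =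
      algebraMap R _ (b j) * algebraMap R _ (∏ i ∈ T, b i) := by
    rw [← map_mul, ← Finset.prod_insert hj]
  obtain ⟨d, rfl⟩ := Nat.exists_eq_add_of_le hn
  simp only [Nat.add_sub_cancel_left, Algebra.smul_def, map_pow, hp]
  ring

theorem exists_pow_smul_eq_zero {T : Finset (Fin t)} {j : Fin t} {y : CechLoc b T}
    (h : cechRestrict b (Finset.subset_insert j T) y = 0) :
    ∃ N, ∀ n ≥ N, b j ^ n • y = 0 := by
  obtain ⟨m, r, hr⟩ := IsLocalization.Away.surj (∏ i ∈ T, b i) y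
  have h0 : algebraMap R (CechLoc b (insert j T)) r = algebraMap R _ 0 := by
    rw [← AlgHom.commutes (cechRestrict b (Finset.subset_insert j T)), ← hr, map_mul, h, zero_mul,
      map_zero]
  obtain ⟨N, hN⟩ := IsLocalization.Away.exists_of_eq (∏ i ∈ insert j T, b i) h0
  refine ⟨N, fun n hn => ?_⟩
  have hu : IsUnit (algebraMap R (CechLoc b T) (∏ i ∈ T, b i)) :=
    IsLocalization.Away.algebraMap_isUnit _
  have hz : (∏ i ∈ T, b i) ^ N * (b j ^ N * r) = 0 := by
    by_cases hj : j ∈ T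
    · rw [Finset.insert_eq_self.2 hj, mul_zero] at hN
      rw [mul_left_comm, hN, mul_zero]
    · rw [Finset.prod_insert hj, mul_zero, mul_pow] at hN
      rw [← hN]; ring
  obtain ⟨d, rfl⟩ := Nat.exists_eq_add_of_le hn
  apply ((hu.pow N).mul (hu.pow m)).mul_left_cancel
  have hz' := congrArg (algebraMap R (CechLoc b T)) hz
  simp only [map_mul, map_pow, ← hr, map_zero] at hz'
  rw [mul_zero, Algebra.smul_def, map_pow]
  linear_combination (algebraMap R (CechLoc b T) (b j)) ^ d * hz'

/-- The restriction to `R_{a_U}` of the component `c S`, for `S ⊆ U`, and `0` otherwise. -/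
def restrictTo (U : Finset (Fin t)) (c : CechCochain b) (S : Finset (Fin t)) : CechLoc b U :=
  if h : S ⊆ U then cechRestrict b h (c S) else 0

theorem restrictTo_of_subset {S U : Finset (Fin t)} (h : S ⊆ U) (c : CechCochain b) :
    restrictTo b U c S = cechRestrict b h (c S) := dif_pos h

theorem restrictTo_eq_zero {S : Finset (Fin t)} (U : Finset (Fin t)) {c : CechCochain b}
    (h : c S = 0) : restrictTo b U c S = 0 := by
  unfold restrictTo; split_ifs
  · rw [h, map_zero]
  · rfl

theorem cechRestrict_cechD {T U : Finset (Fin t)} (h : T ⊆ U) (c : CechCochain b) :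
    cechRestrict b h (cechD b c T) =
      ∑ j ∈ T, (alternatingSign j T : CechLoc b U) * restrictTo b U c (T.erase j) := by
  rw [cechD_apply, map_sum]
  refine Finset.sum_congr rfl fun j _ => ?_
  rw [map_zsmul, zsmul_eq_mul, cechRestrict_comp,
      restrictTo_of_subset b ((Finset.erase_subset j T).trans h)]

theorem cechD_eq_zero_of_erase {c : CechCochain b} {T : Finset (Fin t)}
    (h : ∀ j ∈ T, c (T.erase j) = 0) : cechD b c T = 0 := by
  rw [← cechRestrict_self b subset_rfl (cechD b c T), cechRestrict_cechD]
  exact Finset.sum_eq_zero fun j hj => by rw [restrictTo_eq_zero b T (h j hj), mul_zero]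

/-- A Čech cocycle vanishing on the subsets of `V` becomes, after multiplication with a power of
`b j` for some `j ∈ V`, a coboundary on the subsets of `V ∪ {k}`. -/
theorem exists_cechD_eq_pow_smul {V : Finset (Fin t)} {j k : Fin t} (hj : j ∈ V)
    (hk : k ∉ V) {w : CechCochain b} (hd : cechD b w = 0) (hw : ∀ T ⊆ V, w T = 0) :
    ∃ (N : ℕ) (u : CechCochain b), (∀ T, k ∉ T → u T = 0) ∧
      ∀ T ⊆ insert k V, cechD b u T = b j ^ N • w T := by
  have hjk : j ≠ k := fun h => hk (h ▸ hj)
  have h1 : ∀ T : Finset (Fin t), ∃ N, ∀ n ≥ N, j ∉ T → ∃ l : CechLoc b T,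
      cechRestrict b (Finset.subset_insert j T) l = b j ^ n • w (insert j T) := by
    intro T
    by_cases h : j ∈ T
    · exact ⟨0, fun _ _ h' => (h' h).elim⟩
    · obtain ⟨N, hN⟩ := exists_cechRestrict_eq_pow_smul b h (w (insert j T))
      exact ⟨N, fun n hn _ => hN n hn⟩
  choose N₀ hN₀ using h1
  set N := Finset.univ.sup N₀ with hN
  choose! l hl using fun T => hN₀ T N (Finset.le_sup (Finset.mem_univ T))
  -- The usual contraction in direction j sends w to T ↦ ± w(T ∪ {j}). It takes values in too large
  -- a localization, so `b j ^ N • w` is lifted instead, and only sets containing k are kept.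
  let g : CechCochain b := fun T =>
      if j ∉ T ∧ k ∈ T then (alternatingSign j T : CechLoc b T) * l T else 0
  have hgk : ∀ T, k ∉ T → g T = 0 := fun T hT => if_neg fun h => hT h.2
  have hg1 : ∀ U S : Finset (Fin t), insert j S ⊆ U → j ∉ S → k ∈ S →
      restrictTo b U g S = (alternatingSign j S : CechLoc b U) *
        (b j ^ N • restrictTo b U w (insert j S)) := by
    intro U S hU hjS hkS
    rw [restrictTo_of_subset b hU, restrictTo_of_subset b ((Finset.subset_insert j S).trans hU),
      ← map_smul, ← hl S hjS, cechRestrict_comp]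
    simp only [g, if_pos (And.intro hjS hkS), map_mul, map_intCast]
  have h2 : ∀ T : Finset (Fin t), ∃ N', ∀ n ≥ N', T ⊆ insert k V →
      b j ^ n • (cechD b g T - b j ^ N • w T) = 0 := by
    intro T
    by_cases hT : T ⊆ insert k V
    swap
    · exact ⟨0, fun _ _ h => (hT h).elim⟩
    by_cases hkT : k ∈ T
    swap
    · refine ⟨0, fun n _ _ => ?_⟩
      rw [hw T fun x hx => (Finset.mem_insert.1 (hT hx)).resolve_left fun h => hkT (h ▸ hx),
        cechD_eq_zero_of_erase b fun i _ => hgk _ fun h => hkT (Finset.mem_of_mem_erase h)]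
      simp
    -- The homotopy identity need only hold after inverting `b j`; a further power of `b j` then
    -- kills the error.
    suffices hs : cechRestrict b (Finset.subset_insert j T) (cechD b g T - b j ^ N • w T) = 0 by
      obtain ⟨N', h'⟩ := exists_pow_smul_eq_zero b hs
      exact ⟨N', fun n hn _ => h' n hn⟩
    rw [map_sub, sub_eq_zero, cechRestrict_cechD, map_smul,
      ← restrictTo_of_subset b (Finset.subset_insert j T)]
    by_cases hjT : j ∈ T
    · rw [Finset.sum_eq_single_of_mem j hjT]
      · rw [hg1 _ _ (Finset.insert_subset_insert _ (Finset.erase_subset _ _)) (by simp)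
          (by simp [hkT, hjk.symm]), Finset.insert_erase hjT, alternatingSign_erase_self,
              ← mul_assoc,
          ← Int.cast_mul, alternatingSign_mul_self, Int.cast_one, one_mul]
      · intro i _ hij
        rw [restrictTo_eq_zero, mul_zero]
        exact if_neg fun h => h.1 (by simp [hjT, hij.symm])
    · have h3 : ∀ i ∈ T, (alternatingSign i T : CechLoc b (insert j T)) *
          restrictTo b (insert j T) g (T.erase i) =
          -((alternatingSign j T : CechLoc b (insert j T)) * (b j ^ N •
            ((alternatingSign i (insert j T) : CechLoc b (insert j T)) *
            restrictTo b (insert j T) w ((insert j T).erase i)))) := by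
        intro i hi
        have hij : j ≠ i := fun h => hjT (h ▸ hi)
        rw [Finset.erase_insert_of_ne hij]
        -- Discarding the sets without k costs nothing: the index set of the missing term lies in V,
        -- where w vanishes.
        by_cases hik : i = k
        · subst hik
          rw [restrictTo_eq_zero b _ (hgk _ (by simp)), restrictTo_eq_zero b _ (hw _ _)]
          · simp
          · refine Finset.insert_subset hj fun x hx => ?_
            exact (Finset.mem_insert.1 (hT (Finset.mem_of_mem_erase hx))).resolve_left
              (Finset.ne_of_mem_erase hx)
        · rw [hg1 _ _ (Finset.insert_subset_insert _ (Finset.erase_subset _ _))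
            (fun h => hjT (Finset.mem_of_mem_erase h))
            (Finset.mem_erase.2 ⟨fun h => hik h.symm, hkT⟩), ← mul_assoc,
            ← Int.cast_mul, alternatingSign_erase hi hjT, Int.cast_neg, Int.cast_mul]
          simp only [Algebra.smul_def]
          ring
      -- The cocycle condition at T ∪ {j} expresses w T through exactly the terms of `h3`.
      have h4 := cechRestrict_cechD b (Finset.Subset.refl (insert j T)) w
      rw [hd, Pi.zero_apply, map_zero, Finset.sum_insert hjT, Finset.erase_insert hjT,
        alternatingSign_insert_self] at h4
      rw [Finset.sum_congr rfl h3, Finset.sum_neg_distrib, ← Finset.mul_sum, ← Finset.smul_sum,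
        ← neg_eq_of_add_eq_zero_right h4.symm, smul_neg, mul_neg, neg_neg, ← mul_smul_comm,
        ← mul_assoc, ← Int.cast_mul, alternatingSign_mul_self, Int.cast_one, one_mul]
  choose N₁ hN₁ using h2
  refine ⟨Finset.univ.sup N₁ + N, b j ^ Finset.univ.sup N₁ • g, fun T hT => ?_, fun T hT => ?_⟩
  · rw [Pi.smul_apply, hgk T hT, smul_zero]
  · have := hN₁ T _ (Finset.le_sup (Finset.mem_univ T)) hT
    rw [smul_sub, sub_eq_zero] at this
    rw [map_smul, Pi.smul_apply, this, smul_smul, pow_add]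

/-- The scalars r for which r w is such a coboundary form an ideal J. Its radical contains every b_j
with j ∈ U, hence b_k. As only sets containing k matter, and b_k is invertible there, the power of
b_k can be divided out. -/
theorem exists_cechD_eq_on_insert {U V : Finset (Fin t)} {k : Fin t} (hUV : U ⊆ V) (hk : k ∉ V)
    (hb : b k ∈ Ideal.span (b '' U)) {w : CechCochain b} (hd : cechD b w = 0)
    (hw : ∀ T ⊆ V, w T = 0) :
    ∃ u : CechCochain b, (∀ T, k ∉ T → u T = 0) ∧ ∀ T ⊆ insert k V, cechD b u T = w T := by
  let J : Ideal R :=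
    { carrier := {r | ∃ u : CechCochain b, (∀ T, k ∉ T → u T = 0) ∧
        ∀ T ⊆ insert k V, cechD b u T = r • w T}
      add_mem' := by
        rintro r r' ⟨u, hu, hu'⟩ ⟨v, hv, hv'⟩
        refine ⟨u + v, fun T hT => ?_, fun T hT => ?_⟩
        · rw [Pi.add_apply, hu T hT, hv T hT, add_zero]
        · rw [map_add, Pi.add_apply, hu' T hT, hv' T hT, add_smul]
      zero_mem' := ⟨0, fun _ _ => rfl, fun T _ => by simp⟩
      smul_mem' := by
        rintro r r' ⟨u, hu, hu'⟩
        refine ⟨r • u, fun T hT => ?_, fun T hT => ?_⟩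
        · rw [Pi.smul_apply, hu T hT, smul_zero]
        · rw [map_smul, Pi.smul_apply, hu' T hT, smul_smul, smul_eq_mul] }
  have hJ : Ideal.span (b '' U) ≤ J.radical := by
    rw [Ideal.span_le]
    rintro _ ⟨j, hj, rfl⟩
    obtain ⟨N, u, hu⟩ := exists_cechD_eq_pow_smul b (hUV hj) hk hd hw
    exact ⟨N, u, hu⟩
  obtain ⟨N, u, hu, hu'⟩ := hJ hb
  have hunit : ∀ T : Finset (Fin t),
      ∃ v : CechLoc b T, k ∈ T → v * algebraMap R _ (b k ^ N) = 1 := by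
    intro T
    by_cases hT : k ∈ T
    · obtain ⟨v, hv⟩ := ((isUnit_algebraMap_cechLoc b hT).pow N).exists_left_inv
      exact ⟨v, fun _ => by rw [map_pow, hv]⟩
    -- The value 0 is harmless, since u vanishes on sets without k.
    · exact ⟨0, fun h => (hT h).elim⟩
  choose v hv using hunit
  have huv : b k ^ N • (fun T => v T * u T : CechCochain b) = u := by
    funext T
    by_cases hT : k ∈ T
    · rw [Pi.smul_apply, Algebra.smul_def, ← mul_assoc, mul_comm _ (v T), hv T hT, one_mul]
    · rw [Pi.smul_apply, hu T hT, mul_zero, smul_zero]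
  refine ⟨fun T => v T * u T, fun T hT => by simp only [hu T hT, mul_zero], fun T hT => ?_⟩
  by_cases hkT : k ∈ T
  · have h := hu' T hT
    rw [← huv, map_smul, Pi.smul_apply, Algebra.smul_def, Algebra.smul_def, map_pow] at h
    exact ((isUnit_algebraMap_cechLoc b hkT).pow N).mul_left_cancel h
  · rw [cechD_eq_zero_of_erase, hw T]
    · exact fun x hx => (Finset.mem_insert.1 (hT hx)).resolve_left fun h => hkT (h ▸ hx)
    · intro i _
      rw [hu _ fun h => hkT (Finset.mem_of_mem_erase h), mul_zero]

/-- If the `b k` lie in the ideal generated by the `b j` with `j ∈ U`, the complex of cochains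
vanishing on the subsets of `U` is acyclic. -/
theorem exists_cechD_eq_of_vanishing {U : Finset (Fin t)}
    (hb : ∀ k, b k ∈ Ideal.span (b '' U)) {w : CechCochain b} (hd : cechD b w = 0)
    (hw : ∀ T ⊆ U, w T = 0) :
    ∃ u : CechCochain b, (∀ T ⊆ U, u T = 0) ∧ cechD b u = w := by
  -- V grows from U to the full index set, one index at a time. Each correction is supported on sets
  -- containing the new index, so it still vanishes on subsets of U.
  suffices h : ∀ (m : ℕ) (V : Finset (Fin t)), U ⊆ V → Vᶜ.card = m → ∀ w : CechCochain b,
      cechD b w = 0 → (∀ T ⊆ V, w T = 0) →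
      ∃ u : CechCochain b, (∀ T ⊆ U, u T = 0) ∧ cechD b u = w from
    h _ U subset_rfl rfl w hd hw
  intro m
  induction m with
  | zero =>
    intro V _ hV w _ hw
    refine ⟨0, fun _ _ => rfl, ?_⟩
    rw [map_zero]
    funext T
    rw [hw T ?_, Pi.zero_apply]
    rw [Finset.card_eq_zero, Finset.compl_eq_empty_iff] at hV
    rw [hV]; exact Finset.subset_univ T
  | succ m ih =>
    intro V hUV hV w hd hw
    obtain ⟨k, hk⟩ : Vᶜ.Nonempty := by rw [← Finset.card_pos, hV]; omega
    have hk' := hk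
    rw [Finset.mem_compl] at hk
    obtain ⟨u, hu, hu'⟩ := exists_cechD_eq_on_insert b hUV hk (hb k) hd hw
    obtain ⟨u₁, h1, h1'⟩ := ih (insert k V) (hUV.trans (Finset.subset_insert k V))
      (by rw [Finset.compl_insert, Finset.card_erase_of_mem hk', hV, Nat.add_sub_cancel])
      (w - cechD b u) (by rw [map_sub, hd, cechD_comp_cechD, sub_zero])
      (fun T hT => by rw [Pi.sub_apply, hu' T hT, sub_self])
    refine ⟨u₁ + u, fun T hT => ?_, by rw [map_add, h1', sub_add_cancel]⟩
    rw [Pi.add_apply, h1 T hT, hu T fun h => hk (hUV (hT h)), add_zero]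

end CechAcyclic

/-! ### Passing to a subsequence of generators. -/

section CechReindex

variable {R : Type*} [CommRing R]

/-- The localization map `R_x → R_y` when `x` divides `y`. -/
def awayHom {x y : R} (h : x ∣ y) : Localization.Away x →ₐ[R] Localization.Away y :=
  IsLocalization.Away.liftAlgHom x (f := Algebra.ofId R (Localization.Away y))
    (IsLocalization.Away.isUnit_of_dvd (S := Localization.Away y) y h)

/-- Uniqueness of R-algebra maps out of a localization makes every compatibility of restriction maps
automatic. -/
theorem algHom_away_eq {A : Type*} [CommRing A] [Algebra R A] {x : R}
    (f g : Localization.Away x →ₐ[R] A) (z : Localization.Away x) : f z = g z := by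
  have := IsLocalization.algHom_subsingleton (R := R) (S := Localization.Away x) (P := A)
    (Submonoid.powers x)
  rw [Subsingleton.elim f g]

theorem awayHom_comp {x y z : R} (h : x ∣ y) (h' : y ∣ z) (u : Localization.Away x) :
    awayHom h' (awayHom h u) = awayHom (h.trans h') u :=
  algHom_away_eq ((awayHom h').comp (awayHom h)) (awayHom (h.trans h')) u

theorem awayHom_self {x : R} (h : x ∣ x) (u : Localization.Away x) : awayHom h u = u :=
  algHom_away_eq (awayHom h) (AlgHom.id R _) u

variable {s t : ℕ} (b : Fin t → R) (e : Fin s ↪o Fin t)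

theorem cechRestrict_eq_awayHom {S T : Finset (Fin t)} (h : S ⊆ T) (u : CechLoc b S) :
    cechRestrict b h u = awayHom (Finset.prod_dvd_prod_of_subset S T b h) u := rfl

theorem prod_comp_eq (S : Finset (Fin s)) :
    ∏ j ∈ S, (b ∘ e) j = ∏ j ∈ S.map e.toEmbedding, b j := by
  rw [Finset.prod_map]; rfl

/-- The restriction of Čech cochains to a subsequence. -/
def cechPull : CechCochain b →ₗ[R] CechCochain (b ∘ e) :=
  LinearMap.pi fun S => (awayHom (prod_comp_eq b e S).symm.dvd).toLinearMap ∘ₗ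
    LinearMap.proj (S.map e.toEmbedding)

theorem cechPull_apply (c : CechCochain b) (S : Finset (Fin s)) :
    cechPull b e c S = awayHom (prod_comp_eq b e S).symm.dvd (c (S.map e.toEmbedding)) := rfl

theorem alternatingSign_map (j : Fin s) (S : Finset (Fin s)) :
    alternatingSign (e j) (S.map e.toEmbedding) = alternatingSign j S := by
  unfold alternatingSign
  rw [Finset.filter_map, Finset.card_map]
  congr 3
  ext i
  simp

/-- Components at equal index sets have different types; comparing their images in a common
localization avoids casts. -/
theorem awayHom_congr (c : CechCochain b) {U V : Finset (Fin t)} (h : U = V) {y : R}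
    (hU : (∏ j ∈ U, b j) ∣ y) (hV : (∏ j ∈ V, b j) ∣ y) :
    awayHom hU (c U) = awayHom hV (c V) := by
  subst h; rfl

theorem cechPull_cechD (c : CechCochain b) :
    cechPull b e (cechD b c) = cechD (b ∘ e) (cechPull b e c) := by
  funext S
  rw [cechPull_apply, cechD_apply, cechD_apply, map_sum, Finset.sum_map]
  refine Finset.sum_congr rfl fun j _ => ?_
  have h1 : alternatingSign (e.toEmbedding j) (S.map e.toEmbedding) = alternatingSign j S :=
    alternatingSign_map e j S
  have h2 : (S.erase j).map e.toEmbedding = (S.map e.toEmbedding).erase (e.toEmbedding j) :=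
    Finset.map_erase _ _ _
  rw [map_zsmul, h1, cechPull_apply]
  congr 1
  rw [cechRestrict_eq_awayHom, cechRestrict_eq_awayHom, awayHom_comp, awayHom_comp]
  exact awayHom_congr b c h2.symm _ _

theorem cechPull_eq_zero_iff (c : CechCochain b) :
    cechPull b e c = 0 ↔ ∀ T ⊆ Finset.univ.map e.toEmbedding, c T = 0 := by
  constructor
  · intro h T hT
    obtain ⟨S, -, rfl⟩ := Finset.subset_map_iff.1 hT
    have h1 := congrFun h S
    rw [cechPull_apply, Pi.zero_apply] at h1
    have h2 := congrArg (awayHom (prod_comp_eq b e S).dvd) h1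
    rw [map_zero] at h2
    rwa [awayHom_comp, awayHom_self] at h2
  · intro h
    funext S
    rw [cechPull_apply, h _ (Finset.map_subset_map.2 (Finset.subset_univ S)), map_zero,
      Pi.zero_apply]

theorem cechPull_surjective : Function.Surjective (cechPull b e) := by
  intro c
  have hd : ∀ T : Finset (Fin t), (∏ j ∈ Finset.univ.filter (e · ∈ T), (b ∘ e) j) ∣
      ∏ j ∈ T, b j := fun T => by
    rw [prod_comp_eq]
    refine Finset.prod_dvd_prod_of_subset _ _ _ fun x hx => ?_
    simp only [Finset.mem_map, Finset.mem_filter, Finset.mem_univ, true_and] at hx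
    obtain ⟨i, hi, rfl⟩ := hx
    exact hi
  -- The component at T is taken from the preimage of T under e. This section need not commute with
  -- the differentials.
  refine ⟨fun T => awayHom (hd T) (c _), ?_⟩
  funext S
  have hS : Finset.univ.filter (e · ∈ S.map e.toEmbedding) = S := by
    ext i; simp
  rw [cechPull_apply, awayHom_comp, awayHom_congr (b ∘ e) c hS _ dvd_rfl, awayHom_self]

/-! ### Homogeneous components of Čech cochains. -/

section Truncation

variable {t : ℕ} (b : Fin t → R)

/-- The homogeneous component of degree `p` of a Čech cochain. -/
def cechTrunc (p : ℕ) (c : CechCochain b) : CechCochain b :=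
  fun S => if S.card = p then c S else 0

theorem cechTrunc_mem (p : ℕ) (c : CechCochain b) :
    cechTrunc b p c ∈ gradedPiece R (CechLoc b) p := fun _ hS => if_neg hS

theorem cechTrunc_of_mem {p : ℕ} {c : CechCochain b} (hc : c ∈ gradedPiece R (CechLoc b) p) :
    cechTrunc b p c = c := by
  funext S
  unfold cechTrunc
  split_ifs with h
  · rfl
  · exact (hc S h).symm

theorem cechD_cechTrunc (p : ℕ) (c : CechCochain b) :
    cechD b (cechTrunc b p c) = cechTrunc b (p + 1) (cechD b c) := by
  funext T
  rw [← cechRestrict_self b subset_rfl (cechD b _ T), cechRestrict_cechD]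
  unfold cechTrunc
  split_ifs with h
  · rw [← cechRestrict_self b subset_rfl (cechD b c T), cechRestrict_cechD]
    refine Finset.sum_congr rfl fun j hj => ?_
    rw [restrictTo_of_subset b (Finset.erase_subset j T),
      restrictTo_of_subset b (Finset.erase_subset j T),
      if_pos (by rw [Finset.card_erase_of_mem hj, h]; rfl)]
  · refine Finset.sum_eq_zero fun j hj => ?_
    rw [restrictTo_eq_zero, mul_zero]
    refine if_neg fun h' => h ?_
    rw [Finset.card_erase_of_mem hj] at h'
    have := Finset.card_pos.2 ⟨j, hj⟩
    omega

theorem cechD_mem {p : ℕ} {c : CechCochain b} (hc : c ∈ gradedPiece R (CechLoc b) p) :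
    cechD b c ∈ gradedPiece R (CechLoc b) (p + 1) := by
  rw [← cechTrunc_of_mem b hc, cechD_cechTrunc]
  exact cechTrunc_mem b _ _

end Truncation

theorem cechPull_mem_cechCocycles {p : ℕ} {c : CechCochain b} (hc : c ∈ cechCocycles b p) :
    cechPull b e c ∈ cechCocycles (b ∘ e) p := by
  refine ⟨fun S hS => ?_, ?_⟩
  · rw [cechPull_apply, hc.1 _ (by rwa [Finset.card_map]), map_zero]
  · change cechD (b ∘ e) (cechPull b e c) = 0
    rw [← cechPull_cechD, LinearMap.mem_ker.1 hc.2, map_zero]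

theorem cechPull_cechTrunc (p : ℕ) (c : CechCochain b) :
    cechPull b e (cechTrunc b p c) = cechTrunc (b ∘ e) p (cechPull b e c) := by
  funext S
  rw [cechPull_apply]
  unfold cechTrunc
  rw [Finset.card_map]
  split_ifs
  · rfl
  · rw [map_zero]

/-- Restriction to a subsequence on cocycles. -/
def cocyclePull (p : ℕ) : cechCocycles b p →ₗ[R] cechCocycles (b ∘ e) p :=
  (cechPull b e).restrict fun _ hc => cechPull_mem_cechCocycles b e hc

theorem cocyclePull_mem {p : ℕ} (c : cechCocycles b p) (hc : c ∈ cechCoboundaries b p) :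
    cocyclePull b e p c ∈ cechCoboundaries (b ∘ e) p := by
  obtain ⟨y, hy⟩ := hc
  refine ⟨cechPull b e y, ?_⟩
  rw [← cechPull_cechD, hy]; rfl

variable {b e}

/-- Injectivity on cohomology: after lifting the bounding cochain, the difference is a cocycle in
the acyclic kernel of restriction. -/
theorem mem_cechCoboundaries_of_cocyclePull
    (hb : ∀ k, b k ∈ Ideal.span (b '' (Finset.univ.map e.toEmbedding : Finset (Fin t)))) {p : ℕ}
    (c : cechCocycles b p) (hc : cocyclePull b e p c ∈ cechCoboundaries (b ∘ e) p) :
    c ∈ cechCoboundaries b p := by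
  obtain ⟨y, hy⟩ := hc
  obtain ⟨y, rfl⟩ := cechPull_surjective b e y
  rw [← cechPull_cechD] at hy
  obtain ⟨u, -, hu⟩ := exists_cechD_eq_of_vanishing b hb (w := c.1 - cechD b y)
    (by rw [map_sub, cechD_comp_cechD, LinearMap.mem_ker.1 c.2.2, sub_zero])
    ((cechPull_eq_zero_iff b e _).1 (by rw [map_sub, hy]; exact sub_self _))
  exact ⟨u + y, by rw [map_add, hu, sub_add_cancel]; rfl⟩

/-- For an arbitrary lift z, the cochain dz lies in the kernel of restriction, so dz = du with u in
that kernel, and z - u is a cocycle lifting c. Truncation is needed because z and u may be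
inhomogeneous. -/
theorem cocyclePull_surjective
    (hb : ∀ k, b k ∈ Ideal.span (b '' (Finset.univ.map e.toEmbedding : Finset (Fin t)))) (p : ℕ) :
    Function.Surjective (cocyclePull b e p) := by
  intro c
  obtain ⟨z, hz⟩ := cechPull_surjective b e c.1
  obtain ⟨u, hu0, hu⟩ := exists_cechD_eq_of_vanishing b hb (w := cechD b z)
    (cechD_comp_cechD b z) ((cechPull_eq_zero_iff b e _).1 (by
      rw [cechPull_cechD, hz, LinearMap.mem_ker.1 c.2.2]))
  refine ⟨⟨cechTrunc b p (z - u), cechTrunc_mem b p _, ?_⟩, Subtype.ext ?_⟩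
  · change cechD b (cechTrunc b p (z - u)) = 0
    rw [cechD_cechTrunc, map_sub, hu, sub_self]
    funext S
    exact ite_self _
  · change cechPull b e (cechTrunc b p (z - u)) = c.1
    rw [cechPull_cechTrunc, map_sub, hz, (cechPull_eq_zero_iff b e u).2 hu0, sub_zero,
      cechTrunc_of_mem _ c.2.1]

variable {K : Type*} [CommRing K] [Algebra K R]

/-- Čech cohomology does not change when elements of the generated ideal are added to a sequence,
compatibly with the action of derivations. -/
theorem exists_cechCohomology_equiv_comp
    (hb : ∀ k, b k ∈ Ideal.span (b '' (Finset.univ.map e.toEmbedding : Finset (Fin t)))) (p : ℕ) :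
    ∃ E : CechCohomology b p ≃ₗ[K] CechCohomology (b ∘ e) p, ∀ (D : Derivation K R R) x,
      E (cohomologyAction b D p x) = cohomologyAction (b ∘ e) D p (E x) := by
  let f : CechCohomology b p →ₗ[R] CechCohomology (b ∘ e) p :=
    (cechCoboundaries b p).mapQ (cechCoboundaries (b ∘ e) p) (cocyclePull b e p)
      (fun c hc => cocyclePull_mem b e c hc)
  have hf : ∀ c, f (Submodule.Quotient.mk c) = Submodule.Quotient.mk (cocyclePull b e p c) :=
    fun _ => rfl
  have hbij : Function.Bijective f := by
    refine ⟨(injective_iff_map_eq_zero f).2 fun x hx => ?_, fun y => ?_⟩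
    · obtain ⟨c, rfl⟩ := Submodule.Quotient.mk_surjective _ x
      rw [hf, Submodule.Quotient.mk_eq_zero] at hx
      rw [Submodule.Quotient.mk_eq_zero]
      exact mem_cechCoboundaries_of_cocyclePull hb c hx
    · obtain ⟨c, rfl⟩ := Submodule.Quotient.mk_surjective _ y
      obtain ⟨c, rfl⟩ := cocyclePull_surjective hb p c
      exact ⟨_, hf c⟩
  refine ⟨(LinearEquiv.ofBijective f hbij).restrictScalars K, fun D x => ?_⟩
  obtain ⟨c, rfl⟩ := Submodule.Quotient.mk_surjective _ x
  refine congrArg Submodule.Quotient.mk (Subtype.ext (funext fun S => ?_))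
  exact locDerivation_map D (awayHom (prod_comp_eq b e S).symm.dvd) _

end CechReindex

/-! ### Koszul homology under equivariant isomorphisms. -/

section KoszulTransfer

variable {K M M' ι : Type*} [CommRing K] [AddCommGroup M] [Module K M] [AddCommGroup M']
  [Module K M'] [Fintype ι] [LinearOrder ι]

theorem exists_koszulHomology_equiv {φ : ι → Module.End K M} {φ' : ι → Module.End K M'}
    (E : M ≃ₗ[K] M') (hE : ∀ i x, E (φ i x) = φ' i (E x)) (i : ℕ) :
    Nonempty (KoszulHomology φ i ≃ₗ[K] KoszulHomology φ' i) := by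
  let F : (Finset ι → M) ≃ₗ[K] (Finset ι → M') := LinearEquiv.piCongrRight fun _ => E
  have hF : ∀ m T, F m T = E (m T) := fun _ _ => rfl
  have hd : ∀ m, F (koszulD φ m) = koszulD φ' (F m) := by
    intro m
    funext T
    rw [hF, koszulD_apply, koszulD_apply, map_sum]
    refine Finset.sum_congr rfl fun j _ => ?_
    rw [map_zsmul, hE, hF]
  have hmem : ∀ m, F m ∈ koszulCycles φ' i ↔ m ∈ koszulCycles φ i := by
    intro m
    refine and_congr (forall_congr' fun S => imp_congr_right fun _ => ?_) ?_
    · rw [hF, LinearEquiv.map_eq_zero_iff]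
    · change koszulD φ' (F m) = 0 ↔ koszulD φ m = 0
      rw [← hd, LinearEquiv.map_eq_zero_iff]
  have hcyc : (koszulCycles φ i).map F.toLinearMap = koszulCycles φ' i := by
    ext m
    constructor
    · rintro ⟨m, hm, rfl⟩
      exact (hmem m).2 hm
    · intro hm
      obtain ⟨m, rfl⟩ := F.surjective m
      exact ⟨m, (hmem m).1 hm, rfl⟩
  let G := F.ofSubmodules _ _ hcyc
  refine ⟨Submodule.Quotient.equiv _ _ G ?_⟩
  ext z
  constructor
  · rintro ⟨c, ⟨y, hy⟩, rfl⟩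
    refine ⟨F y, ?_⟩
    rw [← hd, hy]; rfl
  · rintro ⟨y, hy⟩
    obtain ⟨c, rfl⟩ := G.surjective z
    obtain ⟨y, rfl⟩ := F.surjective y
    refine ⟨c, ⟨y, F.injective ?_⟩, rfl⟩
    rw [hd, hy]; rfl

end KoszulTransfer

/-! ### Contracting the Koszul complex in one direction. -/

section KoszulHomotopy

variable {K M ι : Type*} [CommRing K] [AddCommGroup M] [Module K M] [LinearOrder ι]

/-- The operator `m e_T ↦ ± (ψ m) e_{T ∪ {i}}` on the Koszul complex. -/
def koszulHomotopy (ψ : Module.End K M) (i : ι) (m : Finset ι → M) : Finset ι → M :=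
  fun T => if i ∈ T then alternatingSign i T • ψ (m (T.erase i)) else 0

/-- In directions k ≠ i the contributions of dh and hd cancel, as ψ commutes with φ_k and the signs
are opposite. Only direction i remains, with the order of composition decided by whether i ∈ T. -/
theorem koszulD_koszulHomotopy_add [Fintype ι] {φ : ι → Module.End K M} {ψ : Module.End K M} {i : ι}
    (hψ : ∀ k, k ≠ i → ∀ x, ψ (φ k x) = φ k (ψ x)) (m : Finset ι → M) (T : Finset ι) :
    koszulD φ (koszulHomotopy ψ i m) T + koszulHomotopy ψ i (koszulD φ m) T =
      if i ∈ T then ψ (φ i (m T)) else φ i (ψ (m T)) := by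
  have hsq : ∀ (T : Finset ι) (x : M), alternatingSign i T • alternatingSign i T • x = x := by
    intro T x
    rw [smul_smul, alternatingSign_mul_self, one_smul]
  by_cases hi : i ∈ T
  · rw [if_pos hi, koszulD_apply, koszulHomotopy, if_pos hi, koszulD_apply]
    obtain ⟨S, hiS, rfl⟩ : ∃ S, i ∉ S ∧ T = insert i S :=
      ⟨T.erase i, by simp, (Finset.insert_erase hi).symm⟩
    rw [Finset.erase_insert hiS]
    have hc : Sᶜ = insert i (insert i S)ᶜ := by
      ext x; by_cases hx : x = i <;> simp [hx, hiS]
    rw [hc, Finset.sum_insert (by simp), alternatingSign_insert_self, map_add,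
        smul_add, map_zsmul, hsq, map_sum,
      Finset.smul_sum]
    rw [add_left_comm, ← Finset.sum_add_distrib, Finset.sum_eq_zero, add_zero]
    intro k hk
    simp only [Finset.mem_compl, Finset.mem_insert, not_or] at hk
    have h1 : (insert k (insert i S)).erase i = insert k S := by
      rw [Finset.insert_comm, Finset.erase_insert]
      simp [Ne.symm hk.1, hiS]
    rw [koszulHomotopy, if_pos (by simp), h1, map_zsmul, map_zsmul, hψ k hk.1, smul_smul, smul_smul,
      Finset.insert_comm, alternatingSign_insert_self, ← add_smul]
    have h2 := alternatingSign_swap hk.1 hk.2 hiS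
    have h3 := alternatingSign_mul_self i S
    have h4 := alternatingSign_mul_self i (insert k S)
    convert zero_smul ℤ _ using 2
    linear_combination (alternatingSign i (insert k S) * alternatingSign i S) * h2 -
      alternatingSign k S * alternatingSign i S * h4 -
      alternatingSign k (insert i S) * alternatingSign i (insert k S) * h3
  · rw [if_neg hi, koszulD_apply, koszulHomotopy, if_neg hi, add_zero,
      Finset.sum_eq_single_of_mem i (by simpa using hi)]
    · rw [koszulHomotopy, if_pos (by simp), Finset.erase_insert hi,
        alternatingSign_insert_self, map_zsmul, hsq]
    · intro k _ hk
      rw [koszulHomotopy, if_neg (by simp [hi, Ne.symm hk]), map_zero, smul_zero]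

theorem koszulHomotopy_zero (ψ : Module.End K M) (i : ι) : koszulHomotopy ψ i 0 = 0 := by
  funext T
  simp [koszulHomotopy]

end KoszulHomotopy

/-! ### Koszul homology of the monomial model. -/

section KoszulModel

variable {K : Type*} [Field K] {m : ℕ}

/-- `δ_α ↦ w (α i + 1) δ_{α + e_i}`. -/
def raiseOp (i : Fin (m + 1)) (w : ℕ → K) : Module.End K ((Fin (m + 1) →₀ ℕ) →₀ K) :=
  Finsupp.lsum K fun α => w (α i + 1) • Finsupp.lsingle (α + Finsupp.single i 1)

/-- `δ_α ↦ w (α i) δ_{α - e_i}`. -/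
def lowerOp (i : Fin (m + 1)) (w : ℕ → K) : Module.End K ((Fin (m + 1) →₀ ℕ) →₀ K) :=
  Finsupp.lsum K fun α => w (α i) • Finsupp.lsingle (α - Finsupp.single i 1)

theorem raiseOp_single (i : Fin (m + 1)) (w : ℕ → K) (α : Fin (m + 1) →₀ ℕ) (c : K) :
    raiseOp i w (Finsupp.single α c) =
      Finsupp.single (α + Finsupp.single i 1) (w (α i + 1) * c) := by
  simp [raiseOp]

theorem lowerOp_single (i : Fin (m + 1)) (w : ℕ → K) (α : Fin (m + 1) →₀ ℕ) (c : K) :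
    lowerOp i w (Finsupp.single α c) =
      Finsupp.single (α - Finsupp.single i 1) (w (α i) * c) := by
  simp [lowerOp]

theorem raiseOp_lowerOp_comm {i k : Fin (m + 1)} (h : i ≠ k) (v w : ℕ → K)
    (x : (Fin (m + 1) →₀ ℕ) →₀ K) : raiseOp i v (lowerOp k w x) = lowerOp k w (raiseOp i v x) := by
  induction x using Finsupp.induction_linear with
  | zero => simp
  | add x y hx hy => simp only [map_add, hx, hy]
  | single α c =>
    simp only [raiseOp_single, lowerOp_single]
    congr 1
    · ext l
      by_cases hl : l = k
      · subst hl; simp [h]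
      · simp [Ne.symm hl]
    · simp [h, h.symm]; ring

theorem raiseOp_comm (i k : Fin (m + 1)) (h : i ≠ k) (v w : ℕ → K)
    (x : (Fin (m + 1) →₀ ℕ) →₀ K) : raiseOp i v (raiseOp k w x) = raiseOp k w (raiseOp i v x) := by
  induction x using Finsupp.induction_linear with
  | zero => simp
  | add x y hx hy => simp only [map_add, hx, hy]
  | single α c =>
    simp only [raiseOp_single]
    congr 1
    · abel
    · simp [h, h.symm]; ring

theorem lowerOp_comm (i k : Fin (m + 1)) (h : i ≠ k) (v w : ℕ → K)
    (x : (Fin (m + 1) →₀ ℕ) →₀ K) : lowerOp i v (lowerOp k w x) = lowerOp k w (lowerOp i v x) := by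
  induction x using Finsupp.induction_linear with
  | zero => simp
  | add x y hx hy => simp only [map_add, hx, hy]
  | single α c =>
    simp only [lowerOp_single]
    congr 1
    · rw [tsub_right_comm]
    · simp [h, h.symm]; ring

/-- The projection onto the span of the `δ_α` with `α i = 0`. -/
def zeroPart (i : Fin (m + 1)) (x : (Fin (m + 1) →₀ ℕ) →₀ K) : (Fin (m + 1) →₀ ℕ) →₀ K :=
  x.filter fun α => α i = 0

theorem lowerOp_raiseOp {v w : ℕ → K} (h : ∀ k, w (k + 1) * v (k + 1) = 1) (i : Fin (m + 1))
    (x : (Fin (m + 1) →₀ ℕ) →₀ K) : lowerOp i w (raiseOp i v x) = x := by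
  induction x using Finsupp.induction_linear with
  | zero => simp
  | add x y hx hy => simp only [map_add, hx, hy]
  | single α c =>
    simp only [raiseOp_single, lowerOp_single]
    simp [← mul_assoc, h]

/-- Truncated subtraction fixes α when `α i = 0`, so `w 0 = 0` is what makes lowering kill δ_α
there; elsewhere the weights cancel. -/
theorem raiseOp_lowerOp {v w : ℕ → K} (h : ∀ k, w (k + 1) * v (k + 1) = 1) (h0 : w 0 = 0)
    (i : Fin (m + 1)) (x : (Fin (m + 1) →₀ ℕ) →₀ K) :
    raiseOp i v (lowerOp i w x) = x - zeroPart i x := by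
  unfold zeroPart
  rw [eq_sub_iff_add_eq]
  induction x using Finsupp.induction_linear with
  | zero => simp [Finsupp.filter_zero]
  | add x y hx hy =>
    rw [Finsupp.filter_add, map_add, map_add, add_add_add_comm, hx, hy]
  | single α c =>
    simp only [raiseOp_single, lowerOp_single]
    by_cases ha : α i = 0
    · rw [Finsupp.filter_single_of_pos (fun α : Fin (m + 1) →₀ ℕ => α i = 0) ha, ha, h0]; simp
    · rw [Finsupp.filter_single_of_neg (fun α : Fin (m + 1) →₀ ℕ => α i = 0) ha]
      obtain ⟨k, hk⟩ := Nat.exists_eq_succ_of_ne_zero ha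
      have e : α - Finsupp.single i 1 + Finsupp.single i 1 = α :=
        tsub_add_cancel_of_le (by simp [hk])
      rw [e, add_zero]
      simp only [Finsupp.coe_tsub, Pi.sub_apply, Finsupp.single_eq_same, hk, Nat.succ_eq_add_one,
        Nat.add_sub_cancel]
      rw [← mul_assoc, mul_comm (v _), h, one_mul]

/-- The operators corresponding to the partial derivatives in the monomial basis of
`H^m_{(X_1, …, X_m)}(K[X_1, …, X_{m+1}])`. -/
def modelOp (i : Fin (m + 1)) : Module.End K ((Fin (m + 1) →₀ ℕ) →₀ K) :=
  if i = Fin.last m then lowerOp i (fun k => (k : K)) else raiseOp i fun k => -(k : K)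

/-- A one-sided inverse of `modelOp`. -/
def modelInv (i : Fin (m + 1)) : Module.End K ((Fin (m + 1) →₀ ℕ) →₀ K) :=
  if i = Fin.last m then raiseOp i (fun k => (k : K)⁻¹) else lowerOp i fun k => -(k : K)⁻¹

theorem modelInv_modelOp_comm {i k : Fin (m + 1)} (h : k ≠ i) (x : (Fin (m + 1) →₀ ℕ) →₀ K) :
    modelInv i (modelOp k x) = modelOp k (modelInv i x) := by
  unfold modelInv modelOp
  by_cases hi : i = Fin.last m
  · rw [if_pos hi, if_neg fun h' => h (h'.trans hi.symm)]
    exact raiseOp_comm _ _ h.symm _ _ _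
  · rw [if_neg hi]
    split_ifs with hk
    · exact lowerOp_comm _ _ (fun h' => h h'.symm) _ _ _
    · exact (raiseOp_lowerOp_comm h _ _ _).symm

theorem modelOp_commute (i k : Fin (m + 1)) :
    Commute (modelOp i : Module.End K ((Fin (m + 1) →₀ ℕ) →₀ K)) (modelOp k) := by
  by_cases h : i = k
  · rw [h]
  refine LinearMap.ext fun x => ?_
  change modelOp i (modelOp k x) = modelOp k (modelOp i x)
  unfold modelOp
  split_ifs with hi hk hk
  · exact (h (hi.trans hk.symm)).elim
  · exact (raiseOp_lowerOp_comm (Ne.symm h) _ _ _).symm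
  · exact raiseOp_lowerOp_comm h _ _ _
  · exact raiseOp_comm _ _ h _ _ _

/-- The part of a Koszul chain that survives the contraction in direction `i`. -/
def survivor (i : Fin (m + 1)) (z : Finset (Fin (m + 1)) → ((Fin (m + 1) →₀ ℕ) →₀ K)) :
    Finset (Fin (m + 1)) → ((Fin (m + 1) →₀ ℕ) →₀ K) :=
  fun T => if (i ∈ T ↔ i = Fin.last m) then zeroPart i (z T) else 0

theorem survivor_eq [CharZero K] (i : Fin (m + 1))
    (z : Finset (Fin (m + 1)) → ((Fin (m + 1) →₀ ℕ) →₀ K)) :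
    survivor i z = z - koszulD modelOp (koszulHomotopy (modelInv i) i z) -
      koszulHomotopy (modelInv i) i (koszulD modelOp z) := by
  funext T
  rw [Pi.sub_apply, Pi.sub_apply, sub_sub,
    koszulD_koszulHomotopy_add (fun k hk x => modelInv_modelOp_comm hk x)]
  unfold survivor modelInv modelOp
  have hk : ∀ k : ℕ, (k + 1 : K) ≠ 0 := fun k => by exact_mod_cast k.succ_ne_zero
  -- In the last direction `modelOp` lowers and `modelInv` raises; in the others the roles are
  -- exchanged. This decides on which T the homotopy is the identity and on which it misses
  -- `zeroPart`.
  by_cases hi : i = Fin.last m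
  · rw [if_pos hi, if_pos hi]
    simp only [hi, iff_true]
    split_ifs
    · rw [raiseOp_lowerOp (by simp [hk]) (by simp), sub_sub_cancel]
    · rw [lowerOp_raiseOp (by simp [hk]), sub_self]
  · rw [if_neg hi, if_neg hi]
    simp only [hi, iff_false]
    have hk' : ∀ k : ℕ, -((k + 1 : ℕ) : K)⁻¹ * -((k + 1 : ℕ) : K) = 1 := fun k => by
      rw [neg_mul_neg, inv_mul_cancel₀ (by exact_mod_cast k.succ_ne_zero)]
    by_cases hT : i ∈ T
    · rw [if_neg (not_not.2 hT), if_pos hT, lowerOp_raiseOp hk', sub_self]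
    -- The convention `0⁻¹ = 0` supplies the vanishing weight at 0.
    · rw [if_pos hT, if_neg hT, raiseOp_lowerOp hk' (by simp), sub_sub_cancel]

/-- Every Koszul cycle is homologous to its part supported on `T = {m}`, `α = 0`. -/
theorem exists_koszulD_sub [CharZero K] (U : Finset (Fin (m + 1)))
    {z : Finset (Fin (m + 1)) → ((Fin (m + 1) →₀ ℕ) →₀ K)} (hz : koszulD modelOp z = 0) :
    ∃ y : Finset (Fin (m + 1)) → ((Fin (m + 1) →₀ ℕ) →₀ K), ∀ T α, (z - koszulD modelOp y) T α =
      if (∀ i ∈ U, α i = 0 ∧ (i ∈ T ↔ i = Fin.last m)) then z T α else 0 := by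
  induction U using Finset.induction_on with
  | empty => exact ⟨0, fun T α => by simp⟩
  | insert i U hi ih =>
    obtain ⟨y, hy⟩ := ih
    have hz' : koszulD modelOp (z - koszulD modelOp y) = 0 := by
      rw [map_sub, hz, koszulD_comp_koszulD modelOp_commute, sub_zero]
    refine ⟨y + koszulHomotopy (modelInv i) i (z - koszulD modelOp y), fun T α => ?_⟩
    have h := survivor_eq i (z - koszulD modelOp y)
    rw [hz', koszulHomotopy_zero, sub_zero] at h
    rw [map_add, ← sub_sub, ← h, survivor]
    simp only [Finset.forall_mem_insert]
    by_cases h1 : (i ∈ T ↔ i = Fin.last m)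
    · rw [if_pos h1, zeroPart, Finsupp.filter_apply, hy]
      simp only [h1, and_true]
      split_ifs <;> first | rfl | simp_all
    · rw [if_neg h1, if_neg fun h2 => h1 h2.1.2]; rfl

/-- Only directions j other than the last contribute here, and these raise, so no output has
exponent 0 at j. Hence this coefficient is well defined on homology. -/
theorem koszulD_modelOp_apply_zero (z : Finset (Fin (m + 1)) → ((Fin (m + 1) →₀ ℕ) →₀ K)) :
    koszulD modelOp z {Fin.last m} 0 = 0 := by
  rw [koszulD_apply, Finsupp.finsetSum_apply]
  refine Finset.sum_eq_zero fun j hj => ?_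
  have hj' : j ≠ Fin.last m := by simpa using hj
  rw [Finsupp.smul_apply, modelOp, if_neg hj']
  convert smul_zero _
  induction z (insert j {Fin.last m}) using Finsupp.induction_linear with
  | zero => simp
  | add x y hx hy => rw [map_add, Finsupp.add_apply, hx, hy, add_zero]
  | single α c =>
    rw [raiseOp_single, Finsupp.single_apply, if_neg]
    intro h
    simpa using congrArg (fun β : Fin (m + 1) →₀ ℕ => β j) h

/-- The generator of the Koszul homology of the monomial model. -/
def modelCycle (m : ℕ) (c : K) : Finset (Fin (m + 1)) → ((Fin (m + 1) →₀ ℕ) →₀ K) :=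
  fun T => if T = {Fin.last m} then Finsupp.single 0 c else 0

theorem modelCycle_mem (c : K) : modelCycle m c ∈ koszulCycles modelOp 1 := by
  refine ⟨fun S hS => if_neg fun h => hS (by rw [h, Finset.card_singleton]), ?_⟩
  change koszulD modelOp (modelCycle m c) = 0
  funext T
  rw [koszulD_apply]
  refine Finset.sum_eq_zero fun j hj => ?_
  unfold modelCycle
  split_ifs with h
  · have hj' : j = Fin.last m := by
      rw [← Finset.mem_singleton, ← h]; exact Finset.mem_insert_self j T
    rw [modelOp, if_pos hj', lowerOp_single]
    simp
  · rw [map_zero, smul_zero]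

theorem exists_sub_koszulD_eq_modelCycle [CharZero K]
    {z : Finset (Fin (m + 1)) → ((Fin (m + 1) →₀ ℕ) →₀ K)} (hz : koszulD modelOp z = 0) :
    ∃ y, z - koszulD modelOp y = modelCycle m (z {Fin.last m} 0) := by
  obtain ⟨y, hy⟩ := exists_koszulD_sub Finset.univ hz
  refine ⟨y, funext fun T => Finsupp.ext fun α => ?_⟩
  rw [hy]
  unfold modelCycle
  by_cases hT : T = {Fin.last m}
  · rw [if_pos hT, hT, Finsupp.single_apply]
    by_cases hα : 0 = α
    · subst hα
      simp
    · rw [if_neg hα, if_neg]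
      exact fun h => hα (Finsupp.ext fun i => (h i (Finset.mem_univ i)).1.symm)
  · rw [if_neg hT, if_neg, Finsupp.zero_apply]
    refine fun h => hT (Finset.ext fun i => ?_)
    rw [Finset.mem_singleton]
    exact (h i (Finset.mem_univ i)).2

theorem subsingleton_koszulHomology_modelOp [CharZero K] {i : ℕ} (hi : i ≠ 1) :
    Subsingleton (KoszulHomology (modelOp : Fin (m + 1) → Module.End K _) i) := by
  refine Submodule.Quotient.subsingleton_iff.2 (eq_top_iff.2 ?_)
  rintro z -
  obtain ⟨y, hy⟩ := exists_sub_koszulD_eq_modelCycle (LinearMap.mem_ker.1 z.2.2)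
  refine ⟨y, ?_⟩
  have h0 : z.1 {Fin.last m} = 0 := z.2.1 _ (by simpa using hi.symm)
  have h1 : modelCycle m (0 : K) = 0 := by
    funext T; simp [modelCycle]
  rw [h0, Finsupp.zero_apply, h1, sub_eq_zero] at hy
  exact hy.symm

theorem koszulHomology_one_modelOp_equiv [CharZero K] :
    Nonempty (KoszulHomology (modelOp : Fin (m + 1) → Module.End K _) 1 ≃ₗ[K] K) := by
  let f : koszulCycles (modelOp : Fin (m + 1) → Module.End K _) 1 →ₗ[K] K :=
    Finsupp.lapply 0 ∘ₗ LinearMap.proj {Fin.last m} ∘ₗ Submodule.subtype _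
  have hf : ∀ z, f z = z.1 {Fin.last m} 0 := fun _ => rfl
  have hker : koszulBoundaries (modelOp : Fin (m + 1) → Module.End K _) 1 = LinearMap.ker f := by
    ext z
    rw [LinearMap.mem_ker, hf]
    constructor
    · rintro ⟨y, hy⟩
      rw [Submodule.subtype_apply] at hy
      rw [← hy, koszulD_modelOp_apply_zero]
    · intro h
      obtain ⟨y, hy⟩ := exists_sub_koszulD_eq_modelCycle (LinearMap.mem_ker.1 z.2.2)
      refine ⟨y, ?_⟩
      have h1 : modelCycle m (0 : K) = 0 := by
        funext T; simp [modelCycle]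
      rw [h, h1, sub_eq_zero] at hy
      exact hy.symm
  have hsurj : Function.Surjective f := fun c => by
    refine ⟨⟨modelCycle m c, modelCycle_mem c⟩, ?_⟩
    rw [hf]
    simp [modelCycle]
  exact ⟨(Submodule.quotEquivOfEq _ _ hker).trans (f.quotKerEquivOfSurjective hsurj)⟩

end KoszulModel

/-! ### Top Čech cohomology as a quotient of R_{a_1 ⋯ a_m}. -/

section TopCech

variable {R : Type*} [CommRing R] {m : ℕ} (a : Fin m → R)

theorem single_univ_mem_cechCocycles (z : CechLoc a Finset.univ) :
    LinearMap.single R (CechLoc a) Finset.univ z ∈ cechCocycles a m := by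
  refine ⟨fun S hS => Pi.single_eq_of_ne (fun h => hS (by simp [h])) z, ?_⟩
  change cechD a (Pi.single Finset.univ z) = 0
  funext T
  refine cechD_eq_zero_of_erase a fun j _ => Pi.single_eq_of_ne (fun h => ?_) z
  exact Finset.notMem_erase j T (h ▸ Finset.mem_univ j)

/-- The map from `R_{a_1 ⋯ a_m}` onto the top Čech cohomology. -/
def topClass : CechLoc a Finset.univ →ₗ[R] CechCohomology a m :=
  (cechCoboundaries a m).mkQ ∘ₗ
    (LinearMap.single R (CechLoc a) Finset.univ).codRestrict _ (single_univ_mem_cechCocycles a)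

theorem eq_single_univ {c : CechCochain a} (hc : c ∈ gradedPiece R (CechLoc a) m) :
    Pi.single Finset.univ (c Finset.univ) = c := by
  funext S
  by_cases hS : S = Finset.univ
  · subst hS; simp
  · rw [Pi.single_eq_of_ne hS, hc S fun h => hS (Finset.eq_univ_of_card S (by simpa using h))]

theorem topClass_surjective : Function.Surjective (topClass a) := by
  intro x
  obtain ⟨c, rfl⟩ := Submodule.Quotient.mk_surjective _ x
  exact ⟨c.1 Finset.univ, congrArg Submodule.Quotient.mk (Subtype.ext (eq_single_univ a c.2.1))⟩

theorem cohomologyAction_topClass {K : Type*} [CommRing K] [Algebra K R] (D : Derivation K R R)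
    (z : CechLoc a Finset.univ) :
    cohomologyAction a D m (topClass a z) = topClass a (locDerivation D _ z) := by
  refine congrArg Submodule.Quotient.mk (Subtype.ext (funext fun S => ?_))
  change locDerivation D _ (Pi.single (M := CechLoc a) Finset.univ z S) =
    Pi.single (M := CechLoc a) Finset.univ (locDerivation D _ z) S
  by_cases hS : S = Finset.univ
  · subst hS; simp
  · rw [Pi.single_eq_of_ne hS, Pi.single_eq_of_ne hS, map_zero]

theorem exists_cechD_univ_of_topClass_eq_zero {z : CechLoc a Finset.univ}
    (h : topClass a z = 0) : ∃ y, cechD a y Finset.univ = z := by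
  obtain ⟨y, hy⟩ := (Submodule.Quotient.mk_eq_zero _).1 h
  refine ⟨y, (congrFun hy Finset.univ).trans ?_⟩
  exact Pi.single_eq_same _ _

theorem topClass_cechRestrict (j : Fin m) (w : CechLoc a (Finset.univ.erase j)) :
    topClass a (cechRestrict a (Finset.erase_subset j Finset.univ) w) = 0 := by
  refine (Submodule.Quotient.mk_eq_zero _).2 ?_
  -- The sign included here cancels the one in the differential.
  let y : CechCochain a := Pi.single (Finset.univ.erase j)
    ((alternatingSign j Finset.univ : CechLoc a (Finset.univ.erase j)) * w)
  have hm : m - 1 + 1 = m := Nat.sub_add_cancel (Fin.pos j)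
  have hy : y ∈ gradedPiece R (CechLoc a) (m - 1) := fun S hS => by
    refine Pi.single_eq_of_ne (fun h => hS ?_) _
    rw [h, Finset.card_erase_of_mem (Finset.mem_univ j), Finset.card_univ, Fintype.card_fin]
  have hdy := cechD_mem a hy
  rw [hm] at hdy
  refine ⟨y, (eq_single_univ a hdy).symm.trans (congrArg (Pi.single Finset.univ) ?_)⟩
  rw [← cechRestrict_self a subset_rfl (cechD a y _), cechRestrict_cechD,
    Finset.sum_eq_single_of_mem j (Finset.mem_univ j)]
  · rw [restrictTo_of_subset a (Finset.erase_subset j _)]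
    simp only [y, Pi.single_eq_same]
    rw [map_mul, map_intCast, ← mul_assoc, ← Int.cast_mul, alternatingSign_mul_self, Int.cast_one,
      one_mul]
  · intro i _ hij
    rw [restrictTo_eq_zero, mul_zero]
    refine Pi.single_eq_of_ne (fun h => ?_) _
    have h1 : i ∈ Finset.univ.erase i := by
      rw [h]; exact Finset.mem_erase.2 ⟨hij, Finset.mem_univ i⟩
    exact Finset.notMem_erase i _ h1

/-- Each component of y has no pole along its omitted a_j, so clearing denominators by (∏ a_i)^N
leaves a spare factor a_j^N. -/
theorem exists_pow_mul_cechD_univ (y : CechCochain a) :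
    ∃ N₀, ∀ N ≥ N₀, ∃ r : Fin m → R, algebraMap R _ (∏ i, a i) ^ N * cechD a y Finset.univ =
      algebraMap R _ (∑ j, a j ^ N * r j) := by
  have h1 := fun j => IsLocalization.Away.surj (∏ i ∈ Finset.univ.erase j, a i)
    (y (Finset.univ.erase j))
  choose n r hr using h1
  refine ⟨Finset.univ.sup n, fun N hN => ⟨fun j => alternatingSign j Finset.univ •
    ((∏ i ∈ Finset.univ.erase j, a i) ^ (N - n j) * r j), ?_⟩⟩
  rw [← cechRestrict_self a subset_rfl (cechD a y _), cechRestrict_cechD, map_sum, Finset.mul_sum]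
  refine Finset.sum_congr rfl fun j _ => ?_
  rw [restrictTo_of_subset a (Finset.erase_subset j _)]
  have h2 := congrArg (cechRestrict a (Finset.erase_subset j Finset.univ)) (hr j)
  rw [map_mul, map_pow, AlgHom.commutes, AlgHom.commutes] at h2
  obtain ⟨d, hd⟩ := Nat.exists_eq_add_of_le
    ((Finset.le_sup (f := n) (Finset.mem_univ j)).trans hN)
  have h3 : algebraMap R (CechLoc a Finset.univ) (∏ i, a i) =
      algebraMap R _ (a j) * algebraMap R _ (∏ i ∈ Finset.univ.erase j, a i) := by
    rw [← map_mul, Finset.mul_prod_erase _ _ (Finset.mem_univ j)]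
  simp only [hd, Nat.add_sub_cancel_left, zsmul_eq_mul, map_mul, map_pow, map_intCast, ← h2, h3]
  ring

end TopCech

/-! ### The Laurent monomial basis and the conclusion. -/

section Model

variable {K : Type*} [Field K] {m : ℕ}

/-- The variables `X_1, …, X_m` of `K[X_1, …, X_{m+1}]`. -/
def coordSeq (K : Type*) [Field K] (m : ℕ) : Fin m → MvPolynomial (Fin (m + 1)) K :=
  fun i => MvPolynomial.X i.castSucc

/-- The exponent with the value `f i` at the first `m` variables and `c` at the last one. -/
def expo (f : Fin m → ℕ) (c : ℕ) : Fin (m + 1) →₀ ℕ :=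
  Finsupp.equivFunOnFinite.symm (Fin.snoc f c : Fin (m + 1) → ℕ)

theorem expo_castSucc (f : Fin m → ℕ) (c : ℕ) (i : Fin m) : expo f c i.castSucc = f i := by
  simp [expo]

theorem expo_last (f : Fin m → ℕ) (c : ℕ) : expo f c (Fin.last m) = c := by
  simp [expo]

theorem expo_ext {α β : Fin (m + 1) →₀ ℕ} (h : ∀ i : Fin m, α i.castSucc = β i.castSucc)
    (h' : α (Fin.last m) = β (Fin.last m)) : α = β := by
  ext i
  induction i using Fin.lastCases with
  | last => exact h'
  | cast i => exact h i

theorem prod_coordSeq_pow (f : Fin m → ℕ) :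
    ∏ i, coordSeq K m i ^ f i = MvPolynomial.monomial (expo f 0) 1 := by
  rw [MvPolynomial.monomial_eq, Finsupp.prod_fintype _ _ (fun _ => pow_zero _),
    Fin.prod_univ_castSucc]
  simp [expo_castSucc, expo_last, coordSeq]

theorem isUnit_algebraMap_monomial (f : Fin m → ℕ) :
    IsUnit (algebraMap _ (CechLoc (coordSeq K m) Finset.univ)
      (MvPolynomial.monomial (expo f 0) (1 : K))) := by
  rw [← prod_coordSeq_pow, map_prod]
  refine Submonoid.prod_mem (IsUnit.submonoid _) fun i _ => ?_
  rw [map_pow]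
  exact (isUnit_algebraMap_cechLoc (coordSeq K m) (Finset.mem_univ i)).pow _

theorem exists_laurent (α : Fin (m + 1) →₀ ℕ) : ∃ z : CechLoc (coordSeq K m) Finset.univ,
    algebraMap (MvPolynomial (Fin (m + 1)) K) _
        (MvPolynomial.monomial (expo (fun i => α i.castSucc + 1) 0) (1 : K)) * z =
      algebraMap (MvPolynomial (Fin (m + 1)) K) _
          (MvPolynomial.monomial (expo (fun _ => 0) (α (Fin.last m))) (1 : K)) := by
  obtain ⟨v, hv⟩ := (isUnit_algebraMap_monomial (K := K) fun i => α i.castSucc + 1).exists_right_inv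
  exact ⟨v * _, by rw [← mul_assoc, hv, one_mul]⟩

/-- The Laurent monomial `X_{m+1}^{α_{m+1}} ∏ X_i^{-1-α_i}`. -/
def laurent (α : Fin (m + 1) →₀ ℕ) : CechLoc (coordSeq K m) Finset.univ :=
  (exists_laurent α).choose

theorem monomial_mul_laurent (α : Fin (m + 1) →₀ ℕ) :
    algebraMap (MvPolynomial (Fin (m + 1)) K) _
        (MvPolynomial.monomial (expo (fun i => α i.castSucc + 1) 0) (1 : K)) *
      (laurent α : CechLoc (coordSeq K m) Finset.univ) =
      algebraMap (MvPolynomial (Fin (m + 1)) K) _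
          (MvPolynomial.monomial (expo (fun _ => 0) (α (Fin.last m))) (1 : K)) :=
  (exists_laurent α).choose_spec

theorem monomial_mul_laurent_add (α : Fin (m + 1) →₀ ℕ) (f : Fin m → ℕ) :
    algebraMap (MvPolynomial (Fin (m + 1)) K) _
        (MvPolynomial.monomial (expo (fun i => α i.castSucc + 1 + f i) 0) (1 : K)) *
      (laurent α : CechLoc (coordSeq K m) Finset.univ) =
      algebraMap (MvPolynomial (Fin (m + 1)) K) _
          (MvPolynomial.monomial (expo f (α (Fin.last m))) (1 : K)) := by
  have h1 : expo (fun i => α i.castSucc + 1 + f i) 0 =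
      expo f 0 + expo (fun i => α i.castSucc + 1) 0 :=
    expo_ext (fun i => by simp [expo_castSucc, add_comm]) (by simp [expo_last])
  have h2 : expo f (α (Fin.last m)) = expo f 0 + expo (fun _ => 0) (α (Fin.last m)) :=
    expo_ext (fun i => by simp [expo_castSucc]) (by simp [expo_last])
  rw [h1, h2, ← mul_one (1 : K), ← MvPolynomial.monomial_mul, ← MvPolynomial.monomial_mul, map_mul,
    map_mul, mul_assoc, monomial_mul_laurent]

theorem eq_laurent {α : Fin (m + 1) →₀ ℕ} {z : CechLoc (coordSeq K m) Finset.univ}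
    (f : Fin m → ℕ)
    (h : algebraMap (MvPolynomial (Fin (m + 1)) K) _
        (MvPolynomial.monomial (expo (fun i => α i.castSucc + 1 + f i) 0) (1 : K)) *
      z = algebraMap (MvPolynomial (Fin (m + 1)) K) _
          (MvPolynomial.monomial (expo f (α (Fin.last m))) (1 : K))) :
    z = laurent α :=
  (isUnit_algebraMap_monomial _).mul_left_cancel (h.trans (monomial_mul_laurent_add α f).symm)

theorem locDerivation_laurent_last (α : Fin (m + 1) →₀ ℕ) :
    locDerivation (MvPolynomial.pderiv (Fin.last m) : Derivation K _ _) _ (laurent α) =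
      (α (Fin.last m) : K) • laurent (α - Finsupp.single (Fin.last m) 1) := by
  apply (isUnit_algebraMap_monomial (K := K) fun i => α i.castSucc + 1).mul_left_cancel
  have h := congrArg (locDerivation (MvPolynomial.pderiv (Fin.last m) : Derivation K _ _) _)
    (monomial_mul_laurent (K := K) α)
  have h2 := monomial_mul_laurent (K := K) (α - Finsupp.single (Fin.last m) 1)
  have h3 : ∀ i : Fin m, (α - Finsupp.single (Fin.last m) 1 : Fin (m + 1) →₀ ℕ) i.castSucc =
      α i.castSucc := by
    intro i; simp
  simp only [h3] at h2
  rw [mul_smul_comm, h2]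
  rw [Derivation.leibniz, locDerivation_algebraMap, locDerivation_algebraMap,
    MvPolynomial.pderiv_monomial, MvPolynomial.pderiv_monomial, expo_last, expo_last] at h
  simp only [Nat.cast_zero, mul_zero, map_zero, add_zero, smul_eq_mul, one_mul] at h
  rw [h]
  have h4 : expo (fun _ => 0) (α (Fin.last m)) - Finsupp.single (Fin.last m) 1 =
      expo (fun _ : Fin m => 0)
          ((α - Finsupp.single (Fin.last m) 1 : Fin (m + 1) →₀ ℕ) (Fin.last m)) :=
    expo_ext (fun i => by simp [expo_castSucc]) (by simp [expo_last])
  rw [h4, ← mul_one (α (Fin.last m) : K), ← smul_eq_mul, ← MvPolynomial.smul_monomial,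
    ← IsScalarTower.coe_toAlgHom' K, map_smul, smul_eq_mul, mul_one]

theorem locDerivation_laurent_castSucc (α : Fin (m + 1) →₀ ℕ) (j : Fin m) :
    locDerivation (MvPolynomial.pderiv j.castSucc : Derivation K _ _) _ (laurent α) =
      (-(α j.castSucc + 1 : ℕ) : K) • laurent (α + Finsupp.single j.castSucc 1) := by
  set D : Derivation K (MvPolynomial (Fin (m + 1)) K) _ := MvPolynomial.pderiv j.castSucc
  have h := congrArg (locDerivation D _) (monomial_mul_laurent (K := K) α)
  have h2 := monomial_mul_laurent (K := K) (α + Finsupp.single j.castSucc 1)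
  apply (isUnit_algebraMap_monomial (K := K)
    fun i => (α + Finsupp.single j.castSucc 1 : Fin (m + 1) →₀ ℕ) i.castSucc + 1).mul_left_cancel
  have h5 : (α + Finsupp.single j.castSucc 1 : Fin (m + 1) →₀ ℕ) (Fin.last m) = α (Fin.last m) := by
    simp
  rw [mul_smul_comm, h2, h5, ← monomial_mul_laurent]
  have h3 : expo (fun i => (α + Finsupp.single j.castSucc 1 : Fin (m + 1) →₀ ℕ) i.castSucc + 1) 0 =
      Finsupp.single j.castSucc 1 + expo (fun i => α i.castSucc + 1) 0 :=
    expo_ext (fun i => by simp [expo_castSucc]; ring) (by simp [expo_last])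
  have h6 : Finsupp.single j.castSucc 1 + (expo (fun i => α i.castSucc + 1) 0 -
      Finsupp.single j.castSucc 1) = expo (fun i => α i.castSucc + 1) 0 :=
    add_tsub_cancel_of_le (by simp [expo_castSucc])
  rw [Derivation.leibniz, locDerivation_algebraMap, locDerivation_algebraMap,
    MvPolynomial.pderiv_monomial, MvPolynomial.pderiv_monomial, expo_castSucc, expo_castSucc] at h
  simp only [Nat.cast_zero, mul_zero, map_zero, one_mul, smul_eq_mul] at h
  -- Multiplying by X_j restores the exponent lowered by differentiation and yields the denominator
  -- of the target Laurent monomial.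
  have h7 := congrArg (fun z => algebraMap _ (CechLoc (coordSeq K m) Finset.univ)
    (MvPolynomial.monomial (Finsupp.single j.castSucc 1) (1 : K)) * z) h
  simp only [mul_add, mul_zero] at h7
  rw [mul_comm (laurent α), ← mul_assoc, ← mul_assoc, ← map_mul, ← map_mul,
    MvPolynomial.monomial_mul, MvPolynomial.monomial_mul, h6, one_mul, one_mul, ← h3] at h7
  rw [eq_neg_of_add_eq_zero_left h7, neg_smul, ← smul_mul_assoc,
    ← IsScalarTower.coe_toAlgHom' K, ← map_smul, MvPolynomial.smul_monomial, smul_eq_mul, mul_one]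

/-- The map from the monomial model to the top local cohomology module. -/
def modelMap (K : Type*) [Field K] (m : ℕ) :
    ((Fin (m + 1) →₀ ℕ) →₀ K) →ₗ[K] CechCohomology (coordSeq K m) m :=
  Finsupp.linearCombination K fun α => topClass (coordSeq K m) (laurent α)

theorem modelMap_apply (f : (Fin (m + 1) →₀ ℕ) →₀ K) :
    modelMap K m f = topClass (coordSeq K m) (f.sum fun α c => c • laurent α) := by
  rw [modelMap, Finsupp.linearCombination_apply, Finsupp.sum, Finsupp.sum, map_sum]
  refine Finset.sum_congr rfl fun α _ => ?_
  exact (((topClass (coordSeq K m)).restrictScalars K).map_smul _ _).symm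

theorem modelMap_modelOp (i : Fin (m + 1)) (f : (Fin (m + 1) →₀ ℕ) →₀ K) :
    modelMap K m (modelOp i f) = partialOp (coordSeq K m) m i (modelMap K m f) := by
  induction f using Finsupp.induction_linear with
  | zero => simp
  | add x y hx hy => simp only [map_add, hx, hy]
  | single α c =>
    have hs : ∀ z : CechLoc (coordSeq K m) Finset.univ, ∀ c : K,
        topClass (coordSeq K m) (c • z) = c • topClass (coordSeq K m) z :=
      fun z c => ((topClass (coordSeq K m)).restrictScalars K).map_smul c z
    have hm : ∀ α c, modelMap K m (Finsupp.single α c) =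
        c • topClass (coordSeq K m) (laurent α) := fun α c => by
      rw [modelMap, Finsupp.linearCombination_single]
    rw [hm, map_smul, partialOp, cohomologyAction_topClass]
    induction i using Fin.lastCases with
    | last =>
      rw [modelOp, if_pos rfl, lowerOp_single, hm, locDerivation_laurent_last, hs, smul_smul,
        mul_comm]
    | cast j =>
      rw [modelOp, if_neg (Fin.castSucc_lt_last j).ne, raiseOp_single, hm,
        locDerivation_laurent_castSucc, hs, smul_smul, mul_comm]

theorem modelMap_surjective : Function.Surjective (modelMap K m) := by
  intro x
  obtain ⟨z, rfl⟩ := topClass_surjective _ x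
  obtain ⟨N, r, hr⟩ := IsLocalization.Away.surj (∏ i, coordSeq K m i) z
  have hu : IsUnit (algebraMap _ (CechLoc (coordSeq K m) Finset.univ)
    (∏ i, coordSeq K m i)) := IsLocalization.Away.algebraMap_isUnit _
  obtain ⟨v, hv⟩ := (hu.pow N).exists_left_inv
  suffices h : topClass (coordSeq K m) (v * algebraMap _ _ r) ∈ LinearMap.range (modelMap K m) by
    rw [← hr, mul_comm z, ← mul_assoc, hv, one_mul] at h
    exact h
  clear hr
  induction r using MvPolynomial.induction_on' with
  | add p q hp hq =>
    rw [map_add, mul_add, map_add]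
    exact add_mem hp hq
  | monomial β c =>
    -- If X_j^N divides the numerator, the pole along X_j disappears and the class is zero.
    -- Otherwise all m exponents of the quotient are negative, which is a basis element.
    by_cases hβ : ∃ j : Fin m, N ≤ β j.castSucc
    · obtain ⟨j, hj⟩ := hβ
      have hu' : IsUnit (algebraMap _ (CechLoc (coordSeq K m) (Finset.univ.erase j))
        (∏ i ∈ Finset.univ.erase j, coordSeq K m i)) := IsLocalization.Away.algebraMap_isUnit _
      obtain ⟨v', hv'⟩ := (hu'.pow N).exists_left_inv
      have e : v * algebraMap (MvPolynomial (Fin (m + 1)) K) _ (MvPolynomial.monomial β c) =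
          cechRestrict (coordSeq K m) (Finset.erase_subset j Finset.univ) (v' *
              algebraMap (MvPolynomial (Fin (m + 1)) K) _
            (MvPolynomial.monomial (β - Finsupp.single j.castSucc N) c)) := by
        apply (hu.pow N).mul_left_cancel
        rw [← mul_assoc, mul_comm _ v, hv, one_mul, map_mul, AlgHom.commutes]
        have h2 := congrArg
          (cechRestrict (coordSeq K m) (Finset.erase_subset j Finset.univ)) hv'
        rw [map_mul, map_pow, AlgHom.commutes, map_one] at h2
        have h3 : algebraMap _ (CechLoc (coordSeq K m) Finset.univ) (∏ i, coordSeq K m i) =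
            algebraMap _ _ (coordSeq K m j) *
              algebraMap _ _ (∏ i ∈ Finset.univ.erase j, coordSeq K m i) := by
          rw [← map_mul, Finset.mul_prod_erase _ _ (Finset.mem_univ j)]
        have h4 : MvPolynomial.monomial β c = coordSeq K m j ^ N *
            MvPolynomial.monomial (β - Finsupp.single j.castSucc N) c := by
          rw [coordSeq, MvPolynomial.X_pow_eq_monomial, MvPolynomial.monomial_mul, one_mul,
            add_tsub_cancel_of_le (by simpa using hj)]
        rw [h3, h4, map_mul, map_pow]
        linear_combination -(algebraMap _ _ (coordSeq K m j) ^ N *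
            algebraMap (MvPolynomial (Fin (m + 1)) K) _
          (MvPolynomial.monomial (β - Finsupp.single j.castSucc N) c)) * h2
      rw [e, topClass_cechRestrict]
      exact zero_mem _
    · push Not at hβ
      let α : Fin (m + 1) →₀ ℕ := expo (fun i => N - 1 - β i.castSucc) (β (Fin.last m))
      have e : v * algebraMap (MvPolynomial (Fin (m + 1)) K) _
          (MvPolynomial.monomial β (1 : K)) = laurent α := by
        apply eq_laurent fun i => β i.castSucc
        have h1 : (fun i : Fin m => α i.castSucc + 1 + β i.castSucc) = fun _ => N := by
          funext i
          simp only [α, expo_castSucc]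
          have := hβ i
          omega
        have h2 : expo (fun i : Fin m => β i.castSucc) (α (Fin.last m)) = β :=
          expo_ext (fun i => by simp [expo_castSucc]) (by simp [expo_last, α])
        rw [h1, h2, ← prod_coordSeq_pow, Finset.prod_pow, map_pow, ← mul_assoc, mul_comm _ v, hv,
          one_mul]
      refine ⟨Finsupp.single α c, ?_⟩
      rw [modelMap_apply, Finsupp.sum_single_index (h := fun α c => c • laurent α)
          (zero_smul _ _), ← e, ← mul_smul_comm,
        ← IsScalarTower.coe_toAlgHom' K, ← map_smul, MvPolynomial.smul_monomial, smul_eq_mul,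
        mul_one]

/-- After multiplication by (X_1 ⋯ X_m)^N, a combination of basis elements becomes a polynomial
whose monomials have all first m exponents below N, while a boundary lands in (X_1^N, …, X_m^N).
Comparing coefficients forces zero. -/
theorem modelMap_injective : Function.Injective (modelMap K m) := by
  rw [injective_iff_map_eq_zero]
  intro f hf
  rw [modelMap_apply] at hf
  obtain ⟨y, hy⟩ := exists_cechD_univ_of_topClass_eq_zero _ hf
  obtain ⟨N₀, hN₀⟩ := exists_pow_mul_cechD_univ (coordSeq K m) y
  -- The second summand bounds every pole order α_i + 1 in the support, so truncated subtraction in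
  -- γ is exact and γ is injective there.
  set N := N₀ + f.support.sup (fun α => ∑ i, (α i + 1)) with hN
  obtain ⟨r, hr⟩ := hN₀ N (Nat.le_add_right _ _)
  have hle : ∀ α ∈ f.support, ∀ i : Fin m, α i.castSucc + 1 ≤ N := fun α hα i =>
    ((Finset.single_le_sum (f := fun i => α i + 1) (fun _ _ => Nat.zero_le _)
      (Finset.mem_univ i.castSucc)).trans
        (Finset.le_sup (f := fun α : Fin (m + 1) →₀ ℕ => ∑ i, (α i + 1)) hα)).trans
        (Nat.le_add_left _ _)
  let γ : (Fin (m + 1) →₀ ℕ) → (Fin (m + 1) →₀ ℕ) := fun α =>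
    expo (fun i => N - (α i.castSucc + 1)) (α (Fin.last m))
  have hinj : Function.Injective (algebraMap (MvPolynomial (Fin (m + 1)) K)
      (CechLoc (coordSeq K m) Finset.univ)) :=
    IsLocalization.injective _ (M := Submonoid.powers (∏ i, coordSeq K m i))
      (powers_le_nonZeroDivisors_of_noZeroDivisors
      (Finset.prod_ne_zero_iff.2 fun i _ => MvPolynomial.X_ne_zero _))
  have key : f.sum (fun α c => MvPolynomial.monomial (γ α) c) =
      ∑ j, coordSeq K m j ^ N * r j := by
    apply hinj
    rw [← hr, hy, Finsupp.sum, Finsupp.sum, map_sum, Finset.mul_sum]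
    refine Finset.sum_congr rfl fun α hα => ?_
    have h1 : (fun i : Fin m => α i.castSucc + 1 + (N - (α i.castSucc + 1))) = fun _ => N :=
      funext fun i => Nat.add_sub_cancel' (hle α hα i)
    have h2 := monomial_mul_laurent_add (K := K) α fun i => N - (α i.castSucc + 1)
    rw [h1, ← prod_coordSeq_pow, Finset.prod_pow, map_pow] at h2
    rw [mul_smul_comm, h2, ← IsScalarTower.coe_toAlgHom' K, ← map_smul,
      MvPolynomial.smul_monomial, smul_eq_mul, mul_one]
  ext α
  by_contra hα
  have hα' : α ∈ f.support := Finsupp.mem_support_iff.2 hα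
  have h1 := congrArg (MvPolynomial.coeff (γ α)) key
  rw [Finsupp.sum, MvPolynomial.coeff_sum, MvPolynomial.coeff_sum,
    Finset.sum_eq_single_of_mem α hα', MvPolynomial.coeff_monomial, if_pos rfl,
    Finset.sum_eq_zero] at h1
  · exact hα h1
  · intro j _
    rw [coordSeq, MvPolynomial.X_pow_eq_monomial, MvPolynomial.coeff_monomial_mul', if_neg]
    rw [Finsupp.single_le_iff, expo_castSucc]
    have := hle α hα' j
    omega
  · intro β hβ hne
    rw [MvPolynomial.coeff_monomial, if_neg]
    refine fun h => hne (expo_ext (fun i => ?_) ?_)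
    · have h2 := DFunLike.congr_fun h i.castSucc
      simp only [γ, expo_castSucc] at h2
      have := hle α hα' i
      have := hle β hβ i
      omega
    · have h2 := DFunLike.congr_fun h (Fin.last m)
      simpa only [γ, expo_last] using h2


/-- The de Rham homology of `H^m_P(K[X_1, …, X_{m+1}])` for `P = (X_1, …, X_m)`. -/
theorem koszulHomology_partialOp [CharZero K] {s : ℕ} (a : Fin s → MvPolynomial (Fin (m + 1)) K)
    (ha : Ideal.span (Set.range a) = Ideal.span (Set.range (coordSeq K m))) :
    (∀ i : ℕ, i ≠ 1 → Subsingleton (KoszulHomology (partialOp a m) i)) ∧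
    Nonempty (KoszulHomology (partialOp a m) 1 ≃ₗ[K] K) := by
  let x := coordSeq K m
  let b : Fin (s + m) → MvPolynomial (Fin (m + 1)) K := Fin.append a x
  have hba : b ∘ Fin.castAddOrderEmb m = a := funext fun i => Fin.append_left a x i
  have hbx : b ∘ Fin.natAddOrderEmb s = x := funext fun i => Fin.append_right a x i
  have hb : ∀ k, b k ∈ Ideal.span (Set.range a) := by
    intro k
    induction k using Fin.addCases with
    | left i =>
      rw [show b (Fin.castAdd m i) = a i from Fin.append_left a x i]
      exact Ideal.subset_span ⟨i, rfl⟩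
    | right i =>
      rw [show b (Fin.natAdd s i) = x i from Fin.append_right a x i, ha]
      exact Ideal.subset_span ⟨i, rfl⟩
  have himage : ∀ {k : ℕ} (e : Fin k ↪o Fin (s + m)),
      b '' (Finset.univ.map e.toEmbedding : Finset _) = Set.range (b ∘ e) := by
    intro k e
    rw [Finset.coe_map, Finset.coe_univ, Set.image_univ, ← Set.range_comp]
    rfl
  have h₁ := exists_cechCohomology_equiv_comp (K := K) (b := b)
    (e := Fin.castAddOrderEmb m) (fun k => by rw [himage, hba]; exact hb k) m
  have h₂ := exists_cechCohomology_equiv_comp (K := K) (b := b)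
    (e := Fin.natAddOrderEmb s) (fun k => by rw [himage, hbx, ← ha]; exact hb k) m
  rw [hba] at h₁
  rw [hbx] at h₂
  obtain ⟨E₁, hE₁⟩ := h₁
  obtain ⟨E₂, hE₂⟩ := h₂
  let E₃ := LinearEquiv.ofBijective (modelMap K m)
    ⟨modelMap_injective, modelMap_surjective⟩
  have hE : ∀ i y, (E₃.trans (E₂.symm.trans E₁)) (modelOp i y) =
      partialOp a m i ((E₃.trans (E₂.symm.trans E₁)) y) := by
    intro i y
    have h2 : ∀ w, E₂.symm (partialOp x m i w) =
        partialOp b m i (E₂.symm w) := fun w => by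
      apply E₂.injective
      rw [partialOp, partialOp, hE₂, E₂.apply_symm_apply, E₂.apply_symm_apply]
    change E₁ (E₂.symm (modelMap K m (modelOp i y))) = _
    rw [modelMap_modelOp]
    exact (congrArg E₁ (h2 _)).trans (hE₁ _ _)
  refine ⟨fun i hi => ?_, ?_⟩
  · obtain ⟨F⟩ := exists_koszulHomology_equiv _ hE i
    have := subsingleton_koszulHomology_modelOp (K := K) (m := m) hi
    exact F.symm.injective.subsingleton
  · obtain ⟨F⟩ := exists_koszulHomology_equiv _ hE 1
    obtain ⟨G⟩ := koszulHomology_one_modelOp_equiv (K := K) (m := m)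
    exact ⟨F.symm.trans G⟩

end Model

end DeRhamLC
end

theorem theorem4p3 {K : Type*} [Field K] [CharZero K] (n : ℕ) (hn : 1 ≤ n)
    (s : ℕ) (a : Fin s → MvPolynomial (Fin n) K)
    (ha : Ideal.span (Set.range a) =
      Ideal.span {x | ∃ i : Fin n, (i : ℕ) < n - 1 ∧ x = MvPolynomial.X i}) :
    (∀ i : ℕ, i ≠ 1 →
      Subsingleton (DeRhamLC.KoszulHomology (DeRhamLC.partialOp a (n - 1)) i)) ∧
    Nonempty (DeRhamLC.KoszulHomology (DeRhamLC.partialOp a (n - 1)) 1 ≃ₗ[K] K) := by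
  -- With n = m + 1, the cohomological degree n - 1 reduces definitionally to m.
  obtain ⟨m, rfl⟩ : ∃ m, n = m + 1 := ⟨n - 1, by omega⟩
  refine DeRhamLC.koszulHomology_partialOp a (ha.trans ?_)
  congr 1
  ext p
  constructor
  · rintro ⟨i, hi, rfl⟩
    exact ⟨⟨i, hi⟩, rfl⟩
  · rintro ⟨i, rfl⟩
    exact ⟨i.castSucc, i.2, rfl⟩
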